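/- Let $\alpha\in(\frac38\pi,\frac12\pi)$ and $\lambda>0$. Consider the following (linear imprecise) bandit. The set of arms is $\mathcal A=\{x\in\mathbb R^2:\|x\|_2=1,\ x_1>0,\ |x_0|\le\cos\alpha\}$, the set of outcomes is $\mathcal D=\{y\in\mathbb R^3: y_2=1,\ y_0^2+y_1^2\le 1\}$, the reward is $r(x,y)=-y_0$, and the hypotheses are parametrized by $\mathcal H=\{\theta\in\mathbb R^2:\|\theta\|_2=1,\ \theta_0>0,\ |\theta_1|\le\cos\alpha\}$. With $$F(x,z,y)=z^{\mathrm t}(I_2+\lambda xx^{\mathrm t})\begin{pmatrix}y_0\\ y_1\end{pmatrix},$$ the hypothesis $\theta$ assigns to the arm $x$ the credal set $H_\theta(x)$ of all Borel probability measures $\zeta$ on $\mathcal D$ such that $y=\mathbb E_{\zeta}[y']\in\mathcal D$ satisfies $F(x,\theta,y)=0$. An agent policy is a Borel map $\varphi:(\mathcal A\times\mathcal D)^*\to\mathcal A$ from finite histories to arms. A nature policy compatible with $\theta$ is a Markov kernel $\nu$ from $(\mathcal A\times\mathcal D)^*\times\mathcal A$ to $\mathcal D$ with $\nu(hx)\in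 H_\theta(x)$ for all $h,x$. Under $\varphi$ and $\nu$, recursively, $x_n=\varphi(x_0y_0\dots x_{n-1}y_{n-1})$ and $y_n\sim\nu(x_0y_0\dots x_{n-1}y_{n-1}x_n)$. The expected regret is $$\mathrm{ERg}_\theta(\varphi;N)=N\cdot\sup_{x\in\mathcal A}\ \inf_{\zeta\in H_\theta(x)}\mathbb E_{y\sim\zeta}[r(x,y)]-\inf_{\nu}\sum_{n=0}^{N-1}\mathbb E_{\varphi\nu}[r(x_n,y_n)],$$ where $\nu$ ranges over the nature policies compatible with $\theta$. Let $\xi$ be the uniform distribution (normalized arc length) on the arc $\mathcal H$. Then for every agent policy $\varphi$ and every integer $N>0$, $\mathrm{ERg}_\theta(\varphi;N)\ge 0$ for all $\theta\in\mathcal H$, and $$\mathbb E_{\theta\sim\xi}\left[\mathrm{ERg}_\theta(\varphi;N)\right]\ \ge\ \frac12\left(\cos\frac{3\pi}8-\cos\alpha\right)\min\left(\left(\frac12-\frac{\alpha}{\pi}\right)(\lambda+1)\tan\frac1{5\sqrt N}-1,\ N\right).$$ In particular, for $\lambda\gg\sqrt N$ the expectation is $\Omega(\min(\lambda/\sqrt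 N,N))$: there are constants $c,C>0$ depending only on $\alpha$ such that for all integers $N>0$, all $\lambda\ge C\sqrt N$ and all agent policies $\varphi$, $$\mathbb E_{\theta\sim\xi}\left[\mathrm{ERg}_\theta(\varphi;N)\right]\ \ge\ c\,\min\left(\frac{\lambda}{\sqrt N},\ N\right).$$ Here $\mathbb E_{\theta\sim\xi}$ is the (lower) integral of a nonnegative function, so measurability in $\theta$ need not be presupposed. -/

import Mathlib

open MeasureTheory ProbabilityTheory
open scoped Matrix ENNReal

noncomputable section

namespace ImpreciseBandit

/-! ### General imprecise bandits

`A` is the space of arms, `D` the space of outcomes. A history of `n` rounds is an element of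
`Fin n → A × D`, so the set of all finite histories is the disjoint union of these over `n`. -/

/-- A hypothesis: a set of probability measures on the outcomes for every arm. -/
abbrev Hypothesis (A D : Type*) [MeasurableSpace D] := A → Set (ProbabilityMeasure D)

/-- An agent policy: a (Borel) measurable map from finite histories to arms. -/
structure AgentPolicy (A D : Type*) [MeasurableSpace A] [MeasurableSpace D] where
  act : (n : ℕ) → (Fin n → A × D) → A
  measurable_act : ∀ n, Measurable (act n)

/-- A nature policy compatible with the hypothesis `H`: a Markov kernel which, given a finite
history and the arm `x` just selected, produces a distribution of outcomes belonging to `H x`. -/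
structure NaturePolicy {A D : Type*} [MeasurableSpace A] [MeasurableSpace D]
    (H : Hypothesis A D) where
  out : (n : ℕ) → Kernel ((Fin n → A × D) × A) D
  markov : ∀ n, IsMarkovKernel (out n)
  compatible : ∀ (n : ℕ) (h : Fin n → A × D) (x : A),
    (⟨out n (h, x), (markov n).isProbabilityMeasure (h, x)⟩ : ProbabilityMeasure D) ∈ H x

section

variable {A D : Type*} [MeasurableSpace A] [MeasurableSpace D]

/-- The conditional law of round `n` given the history of the previous `n` rounds:
the arm is `x = φ(h)`, and the outcome is then sampled from `ν(h x)`. -/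
def roundKernel {H : Hypothesis A D} (φ : AgentPolicy A D) (ν : NaturePolicy H) (n : ℕ) :
    Kernel (Fin n → A × D) (A × D) :=
  Kernel.deterministic (φ.act n) (φ.measurable_act n) ⊗ₖ ν.out n

/-- The law of the history of the first `n` rounds under the agent policy `φ` and the nature
policy `ν`. -/
def historyLaw {H : Hypothesis A D} (φ : AgentPolicy A D) (ν : NaturePolicy H) :
    (n : ℕ) → Measure (Fin n → A × D)
  | 0 => Measure.dirac Fin.elim0
  | n + 1 => (historyLaw φ ν n ⊗ₘ roundKernel φ ν n).map
      (fun p => (Fin.snoc p.1 p.2 : Fin (n + 1) → A × D))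

/-- The lower prevision (minimal expected reward) of the arm `x` under the hypothesis `H`. -/
def lowerPrevision (r : A → D → ℝ) (H : Hypothesis A D) (x : A) : ℝ :=
  ⨅ ζ : H x, ∫ y, r x y ∂((ζ : ProbabilityMeasure D) : Measure D)

/-- The expected total reward over `N` rounds. -/
def totalReward (r : A → D → ℝ) {H : Hypothesis A D} (φ : AgentPolicy A D)
    (ν : NaturePolicy H) (N : ℕ) : ℝ :=
  ∑ n : Fin N, ∫ h, r (h n).1 (h n).2 ∂(historyLaw φ ν N)

/-- The expected regret of the agent policy `φ` over `N` rounds under the hypothesis `H`, against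
the worst nature policy compatible with `H`. -/
def expectedRegret (r : A → D → ℝ) (H : Hypothesis A D) (φ : AgentPolicy A D) (N : ℕ) : ℝ :=
  N * (⨆ x : A, lowerPrevision r H x) - ⨅ ν : NaturePolicy H, totalReward r φ ν N

end

/-- The credal set of all probability measures on `D` whose expected value lies in `U ∩ D`. -/
def credal {Y : Type*} [NormedAddCommGroup Y] [NormedSpace ℝ Y] [MeasurableSpace Y]
    (D : Set Y) (U : Submodule ℝ Y) : Set (ProbabilityMeasure D) :=
  {ζ | ∫ y : D, (y : Y) ∂(ζ : Measure D) ∈ (U : Set Y) ∩ D}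

/-! ### The two-dimensional family -/

/-- The arms: an arc of the unit circle around `(0, 1)`. -/
def Arms (α : ℝ) : Set (EuclideanSpace ℝ (Fin 2)) :=
  {x | ‖x‖ = 1 ∧ 0 < x 1 ∧ |x 0| ≤ Real.cos α}

/-- The outcomes: the unit disk in the plane `y 2 = 1`. -/
def Outcomes : Set (EuclideanSpace ℝ (Fin 3)) :=
  {y | y 2 = 1 ∧ y 0 ^ 2 + y 1 ^ 2 ≤ 1}

/-- The hypothesis parameters: an arc of the unit circle around `(1, 0)`. -/
def Params (α : ℝ) : Set (EuclideanSpace ℝ (Fin 2)) :=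
  {θ | ‖θ‖ = 1 ∧ 0 < θ 0 ∧ |θ 1| ≤ Real.cos α}

/-- The reward function. -/
def reward (α : ℝ) (_x : Arms α) (y : Outcomes) : ℝ := -(y : EuclideanSpace ℝ (Fin 3)) 0

/-- `F(x, z, y) = zᵗ (I + l x xᵗ) (y₀, y₁)ᵗ`, as a linear functional of `y`. -/
def F (l : ℝ) (x z : EuclideanSpace ℝ (Fin 2)) : EuclideanSpace ℝ (Fin 3) →ₗ[ℝ] ℝ where
  toFun y := z.ofLp ⬝ᵥ
    (((1 : Matrix (Fin 2) (Fin 2) ℝ) + l • Matrix.vecMulVec x.ofLp x.ofLp) *ᵥ ![y 0, y 1])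
  map_add' y y' := by
    simp only [Matrix.mulVec, dotProduct, Fin.sum_univ_two, PiLp.add_apply,
      Matrix.cons_val_zero, Matrix.cons_val_one]
    ring
  map_smul' c y := by
    simp only [Matrix.mulVec, dotProduct, Fin.sum_univ_two, PiLp.smul_apply, smul_eq_mul,
      Matrix.cons_val_zero, Matrix.cons_val_one, RingHom.id_apply]
    ring

/-- The hypothesis with parameter `θ`: the arm `x` is assigned the credal set of `ker F_{xθ}`. -/
def hyp (α l : ℝ) (θ : EuclideanSpace ℝ (Fin 2)) : Hypothesis (Arms α) Outcomes :=
  fun x => credal Outcomes (LinearMap.ker (F l x θ))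

/-- The expected regret in this family, as a function of the true parameter `θ`. -/
def regret (α l : ℝ) (θ : EuclideanSpace ℝ (Fin 2)) (φ : AgentPolicy (Arms α) Outcomes)
    (N : ℕ) : ℝ :=
  expectedRegret (reward α) (hyp α l θ) φ N

/-- The uniform distribution on the arc `Params α`. For `α ∈ (0, π / 2)` the arc is the bijective
image of the angle interval `[-(π/2 - α), π/2 - α]` under `t ↦ (cos t, sin t)`, and the uniform
distribution (normalized arc length) is the image of the uniform distribution of the angle. -/
def uniformParams (α : ℝ) : Measure (EuclideanSpace ℝ (Fin 2)) :=
  ((volume : Measure ℝ)[|Set.Icc (-(Real.pi / 2 - α)) (Real.pi / 2 - α)]).map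
    (fun t => !₂[Real.cos t, Real.sin t])

/-- The expectation over `θ` of the regret, as an integral with values in `[0, ∞]`. Mathlib's
`∫⁻` is the lower integral (the supremum of the integrals of measurable minorants), so it does not
presuppose that the regret is a measurable function of `θ`. -/
def bayesRegret (α l : ℝ) (φ : AgentPolicy (Arms α) Outcomes) (N : ℕ) : ℝ≥0∞ :=
  ∫⁻ θ, ENNReal.ofReal (regret α l θ φ N) ∂(uniformParams α)

end ImpreciseBandit

end

noncomputable section

namespace ImpreciseBandit

/-! ### Histories, one-step recursions and regret in general bandits -/

section General

variable {A D : Type*} [MeasurableSpace A] [MeasurableSpace D] {H : Hypothesis A D}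

/-! For an arm `x` put `x' = (x 1, -x 0)`. Nature can answer `x` by one of the two points `(x' ± x)
/ √2`, which do not depend on `θ`. Since `I + l x xᵗ` stretches `x` by `l + 1` and fixes `x'`, the
mean outcome satisfies `θ` once the signs have the bias `tilt`, which is at most `T` in absolute
value unless `x` is within an angle of about `1 / (l T)` of the direction orthogonal to `θ`. Such
far arms cost at least `cos (3π/8) - cos α` per round, because the arm orthogonal to `θ` guarantees
`-cos α`. In the other arms nature plays the worst mean outcome, so no round beats the optimal
value. Hence the regret is at least this gap times the expected number of far arms
(`sum_le_regret`).

It remains to show that the agent rarely leaves the far arms. With fair signs the arms chosen along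
a sign sequence do not depend on `θ`, so each misses the far set with `ξ`-probability at most `ε = 1
/ ((π/2 - α)(l + 1)T)`, and a union bound applies (`one_sub_mul_le_integral_sum_signWeight`). Fair
signs are compared with the true ones by AM-GM: twice the fair weight is at most the true weight
plus a weight inverse to it, whose total mass is at most `(1 - T²)⁻ⁿ`
(`two_mul_sum_halfWeight_sub_le`). For `T = tan (1 / (5√N))` this mass stays below `16/15` up to
round `N`. Summing over the first `K` rounds and choosing `K` (`exists_le_sum_bound`) gives the
bound. -/

instance instIsMarkovKernelOut (ν : NaturePolicy H) (n : ℕ) : IsMarkovKernel (ν.out n) :=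
  ν.markov n

instance instIsMarkovKernelRoundKernel (φ : AgentPolicy A D) (ν : NaturePolicy H) (n : ℕ) :
    IsMarkovKernel (roundKernel φ ν n) := by
  unfold roundKernel; infer_instance

theorem measurable_snoc_pair (n : ℕ) :
    Measurable (fun p : (Fin n → A × D) × (A × D) =>
      (Fin.snoc p.1 p.2 : Fin (n + 1) → A × D)) := by
  refine measurable_pi_iff.2 fun i => ?_
  induction i using Fin.lastCases with
  | last => simpa using measurable_snd
  | cast i => simpa using! (measurable_pi_apply i).comp measurable_fst

instance instIsProbabilityMeasureHistoryLaw (φ : AgentPolicy A D) (ν : NaturePolicy H) (n : ℕ) :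
    IsProbabilityMeasure (historyLaw φ ν n) := by
  induction n with
  | zero => unfold historyLaw; infer_instance
  | succ n ih =>
    unfold historyLaw
    exact Measure.isProbabilityMeasure_map (measurable_snoc_pair n).aemeasurable

theorem roundKernel_apply (φ : AgentPolicy A D) (ν : NaturePolicy H) (n : ℕ)
    (h : Fin n → A × D) :
    roundKernel φ ν n h = (ν.out n (h, φ.act n h)).map (Prod.mk (φ.act n h)) := by
  ext s hs
  unfold roundKernel
  rw [Kernel.compProd_apply hs, Kernel.lintegral_deterministic', Measure.map_apply
    measurable_prodMk_left hs]
  exact Kernel.measurable_kernel_prodMk_left' hs h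

theorem lintegral_historyLaw_succ (φ : AgentPolicy A D) (ν : NaturePolicy H) (n : ℕ)
    {f : (Fin (n + 1) → A × D) → ℝ≥0∞} (hf : Measurable f) :
    ∫⁻ h, f h ∂historyLaw φ ν (n + 1) =
      ∫⁻ h, ∫⁻ y, f (Fin.snoc h (φ.act n h, y)) ∂ν.out n (h, φ.act n h) ∂historyLaw φ ν n := by
  have hm := measurable_snoc_pair (A := A) (D := D) n
  rw [historyLaw, lintegral_map hf hm]
  refine (Measure.lintegral_compProd (hf.comp hm)).trans ?_
  refine lintegral_congr fun h => ?_
  rw [roundKernel_apply, lintegral_map _ measurable_prodMk_left]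
  · rfl
  · exact (hf.comp hm).comp measurable_prodMk_left

theorem totalReward_succ (φ : AgentPolicy A D) (ν : NaturePolicy H) (n : ℕ) {r : A → D → ℝ}
    (hr : Measurable (Function.uncurry r)) {B : ℝ} (hB : ∀ x y, |r x y| ≤ B) :
    totalReward r φ ν (n + 1) = totalReward r φ ν n +
      ∫ h, ∫ y, r (φ.act n h) y ∂ν.out n (h, φ.act n h) ∂historyLaw φ ν n := by
  have hm := measurable_snoc_pair (A := A) (D := D) n
  have hr' : ∀ m (i : Fin m), Measurable fun h : Fin m → A × D => r (h i).1 (h i).2 :=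
    fun m i => hr.comp (measurable_pi_apply i)
  unfold totalReward
  rw [Fin.sum_univ_castSucc]
  congr 1
  · refine Finset.sum_congr rfl fun i _ => ?_
    rw [historyLaw, integral_map hm.aemeasurable (hr' _ _).aestronglyMeasurable]
    simp only [Fin.snoc_castSucc]
    -- Earlier rounds are unaffected by the new one: `historyLaw φ ν n` is the first marginal of its
    -- composition with the Markov kernel.
    conv_rhs => rw [← Measure.fst_compProd (historyLaw φ ν n) (roundKernel φ ν n), Measure.fst]
    rw [integral_map measurable_fst.aemeasurable (hr' _ _).aestronglyMeasurable]
  · rw [historyLaw, integral_map hm.aemeasurable (hr' _ _).aestronglyMeasurable]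
    simp only [Fin.snoc_last]
    rw [Measure.integral_compProd]
    · refine integral_congr_ae (.of_forall fun h => ?_)
      simp only
      rw [roundKernel_apply, integral_map measurable_prodMk_left.aemeasurable]
      exact hr.aestronglyMeasurable
    · exact Integrable.of_bound (C := B) (hr.comp measurable_snd).aestronglyMeasurable
        (.of_forall fun p => hB _ _)

theorem abs_totalReward_le (φ : AgentPolicy A D) (ν : NaturePolicy H) (n : ℕ) {r : A → D → ℝ}
    {B : ℝ} (hB : ∀ x y, |r x y| ≤ B) : |totalReward r φ ν n| ≤ n * B := by
  unfold totalReward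
  refine (Finset.abs_sum_le_sum_abs _ _).trans ?_
  calc _ ≤ ∑ _i : Fin n, B := Finset.sum_le_sum fun i _ => by
        have := norm_integral_le_of_norm_le_const (μ := historyLaw φ ν n)
          (f := fun h => r (h i).1 (h i).2) (.of_forall fun h => hB _ _)
        simpa using this
    _ = n * B := by simp

/-- Against any compatible nature policy, the total reward bounds the regret from below. -/
theorem sub_totalReward_le_expectedRegret (φ : AgentPolicy A D) (ν : NaturePolicy H) (n : ℕ)
    {r : A → D → ℝ} {B : ℝ} (hB : ∀ x y, |r x y| ≤ B) :
    n * (⨆ x : A, lowerPrevision r H x) - totalReward r φ ν n ≤ expectedRegret r H φ n := by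
  unfold expectedRegret
  refine sub_le_sub_left (ciInf_le (f := fun ν : NaturePolicy H => totalReward r φ ν n)
    -- A real infimum lies below its terms only when the family is bounded below; bounded rewards
    -- provide this.
    ⟨-(n * B), ?_⟩ ν) _
  rintro _ ⟨ν', rfl⟩
  exact (abs_le.1 (abs_totalReward_le φ ν' n hB)).1

/-- If the expected reward of every round is at most `S`, and at most `S - c` for arms in `G`, the
total reward is at most `S` per round minus `c` times the expected number of arms in `G`. -/
theorem totalReward_le (φ : AgentPolicy A D) (ν : NaturePolicy H) {r : A → D → ℝ}
    (hr : Measurable (Function.uncurry r)) {B : ℝ} (hB : ∀ x y, |r x y| ≤ B) {S c : ℝ}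
    {G : Set A} (hG : MeasurableSet G)
    (hS : ∀ n h x, ∫ y, r x y ∂ν.out n (h, x) ≤ S - G.indicator (fun _ => c) x) (N : ℕ) :
    totalReward r φ ν N ≤ N * S -
      c * ∑ n ∈ Finset.range N, (historyLaw φ ν n).real (φ.act n ⁻¹' G) := by
  induction N with
  | zero => simp [totalReward]
  | succ n ih =>
    rw [totalReward_succ φ ν n hr hB, Finset.sum_range_succ]
    have hind : Integrable (fun h => G.indicator (fun _ => c) (φ.act n h)) (historyLaw φ ν n) := by
      refine Integrable.of_bound (C := |c|) ?_ (.of_forall fun h => ?_)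
      · exact ((measurable_const.indicator hG).comp (φ.measurable_act n)).aestronglyMeasurable
      · exact norm_indicator_le_norm_self (fun _ => c) _
    have hle : ∫ h, ∫ y, r (φ.act n h) y ∂ν.out n (h, φ.act n h) ∂historyLaw φ ν n ≤
        ∫ h, (S - G.indicator (fun _ => c) (φ.act n h)) ∂historyLaw φ ν n := by
      refine integral_mono ?_ ((integrable_const S).sub hind) fun h => hS n h _
      refine Integrable.of_bound (C := B) ?_ (.of_forall fun h => ?_)
      · have : StronglyMeasurable fun h : Fin n → A × D =>
            ∫ z, r z.1 z.2 ∂roundKernel φ ν n h :=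
          hr.stronglyMeasurable.integral_kernel
        convert this.aestronglyMeasurable using 2 with h
        rw [roundKernel_apply, integral_map measurable_prodMk_left.aemeasurable]
        exact hr.aestronglyMeasurable
      · simpa using norm_integral_le_of_norm_le_const (μ := ν.out n (h, φ.act n h))
          (f := fun y => r (φ.act n h) y) (.of_forall fun y => hB _ _)
    have heq : ∫ h, G.indicator (fun _ => c) (φ.act n h) ∂historyLaw φ ν n =
        c * (historyLaw φ ν n).real (φ.act n ⁻¹' G) := by
      have : (fun h => G.indicator (fun _ => c) (φ.act n h)) =
          (φ.act n ⁻¹' G).indicator (fun _ => c) := rfl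
      rw [this, integral_indicator (φ.measurable_act n hG)]
      simp [mul_comm]
    rw [integral_sub (integrable_const S) hind, heq] at hle
    simp only [integral_const, probReal_univ, one_smul] at hle
    push_cast
    linarith

end General

/-! ### Weighted sign sequences, change of measure and union bound -/

section SignHistories

/-- The weight `1 / 2` for arms in `G` and `0` for the other arms. -/
def halfWeight {A : Type*} (G : Set A) (x : A) (_ : Bool) : ℝ := G.indicator (fun _ => 1 / 2) x

theorem halfWeight_nonneg {A : Type*} (G : Set A) (x : A) (b : Bool) : 0 ≤ halfWeight G x b :=
  Set.indicator_nonneg (fun _ _ => by norm_num) _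

variable {A D : Type*} [MeasurableSpace A] [MeasurableSpace D]

/-- The history of `n` rounds in which the outcome of round `i` is the point `pt x (s i)`, where
`x` is the arm selected by `φ`. -/
def signHistory (φ : AgentPolicy A D) (pt : A → Bool → D) :
    (n : ℕ) → (Fin n → Bool) → (Fin n → A × D)
  | 0, _ => Fin.elim0
  | n + 1, s => Fin.snoc (signHistory φ pt n (Fin.init s))
      (φ.act n (signHistory φ pt n (Fin.init s)),
        pt (φ.act n (signHistory φ pt n (Fin.init s))) (s (Fin.last n)))

/-- The arm selected by `φ` after the sign sequence `s`. -/
def signArm (φ : AgentPolicy A D) (pt : A → Bool → D) (n : ℕ) (s : Fin n → Bool) : A :=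
  φ.act n (signHistory φ pt n s)

/-- The product over the rounds of the weights `w x b`, where `x` is the arm and `b` the sign. -/
def signWeight (φ : AgentPolicy A D) (pt : A → Bool → D) (w : A → Bool → ℝ) :
    (n : ℕ) → (Fin n → Bool) → ℝ
  | 0, _ => 1
  | n + 1, s => signWeight φ pt w n (Fin.init s) *
      w (signArm φ pt n (Fin.init s)) (s (Fin.last n))

theorem sum_sign_succ {M : Type*} [AddCommMonoid M] (n : ℕ) (f : (Fin (n + 1) → Bool) → M) :
    ∑ s, f s = ∑ s : Fin n → Bool, ∑ b, f (Fin.snoc s b) := by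
  rw [← (Fin.snocEquiv fun _ => Bool).sum_comp, Fintype.sum_prod_type, Finset.sum_comm]
  rfl

variable (φ : AgentPolicy A D) (pt : A → Bool → D)

theorem signHistory_snoc (n : ℕ) (s : Fin n → Bool) (b : Bool) :
    signHistory φ pt (n + 1) (Fin.snoc s b) = Fin.snoc (signHistory φ pt n s)
      (signArm φ pt n s, pt (signArm φ pt n s) b) := by
  simp [signHistory, signArm]

theorem signWeight_snoc (w : A → Bool → ℝ) (n : ℕ) (s : Fin n → Bool) (b : Bool) :
    signWeight φ pt w (n + 1) (Fin.snoc s b) =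
      signWeight φ pt w n s * w (signArm φ pt n s) b := by
  simp [signWeight]

theorem sum_signWeight_succ (w : A → Bool → ℝ) (n : ℕ) :
    ∑ s, signWeight φ pt w (n + 1) s =
      ∑ s, signWeight φ pt w n s * ∑ b, w (signArm φ pt n s) b := by
  simp only [sum_sign_succ, signWeight_snoc, Finset.mul_sum]

theorem signWeight_nonneg {w : A → Bool → ℝ} (hw : ∀ x b, 0 ≤ w x b) (n : ℕ)
    (s : Fin n → Bool) : 0 ≤ signWeight φ pt w n s := by
  induction n with
  | zero => exact zero_le_one
  | succ n ih => exact mul_nonneg (ih _) (hw _ _)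

/-- The inequality `v² ≤ u w` passes from the factors to the products; AM-GM then turns the product
into a sum, which is easy to sum over all sign sequences. -/
theorem two_mul_signWeight_le {u v w : A → Bool → ℝ} (hu : ∀ x b, 0 ≤ u x b)
    (hw : ∀ x b, v x b ^ 2 ≤ u x b * w x b)
    (hw0 : ∀ x b, 0 ≤ w x b) (n : ℕ) (s : Fin n → Bool) :
    2 * signWeight φ pt v n s ≤ signWeight φ pt u n s + signWeight φ pt w n s := by
  have key : signWeight φ pt v n s ^ 2 ≤ signWeight φ pt u n s * signWeight φ pt w n s := by
    induction n with
    | zero => simp [signWeight]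
    | succ n ih =>
      simp only [signWeight]
      calc _ = signWeight φ pt v n (Fin.init s) ^ 2 *
            v (signArm φ pt n (Fin.init s)) (s (Fin.last n)) ^ 2 := by ring
        _ ≤ (signWeight φ pt u n (Fin.init s) * signWeight φ pt w n (Fin.init s)) *
            (u (signArm φ pt n (Fin.init s)) (s (Fin.last n)) *
              w (signArm φ pt n (Fin.init s)) (s (Fin.last n))) :=
          mul_le_mul (ih _) (hw _ _) (sq_nonneg _)
            (mul_nonneg (signWeight_nonneg φ pt hu _ _) (signWeight_nonneg φ pt hw0 _ _))
        _ = _ := by ring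
  have h1 := signWeight_nonneg φ pt hu n s
  have h2 := signWeight_nonneg φ pt hw0 n s
  refine abs_le_of_sq_le_sq' ?_ (by positivity) |>.2
  nlinarith [sq_nonneg (signWeight φ pt u n s - signWeight φ pt w n s)]

theorem sum_signWeight_le_pow {w : A → Bool → ℝ} (hw : ∀ x b, 0 ≤ w x b) {C : ℝ} (hC : 0 ≤ C)
    (hwC : ∀ x, ∑ b, w x b ≤ C) (n : ℕ) : ∑ s, signWeight φ pt w n s ≤ C ^ n := by
  induction n with
  | zero => simp [signWeight]
  | succ n ih =>
    rw [sum_signWeight_succ, pow_succ]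
    refine le_trans (Finset.sum_le_sum fun s _ =>
      mul_le_mul_of_nonneg_left (hwC _) (signWeight_nonneg φ pt hw n s)) ?_
    rw [← Finset.sum_mul]
    exact mul_le_mul_of_nonneg_right ih hC

variable {H : Hypothesis A D} (ν : NaturePolicy H)

/-- If the law of the outcome dominates the weighted sum of point masses at `pt x b`, then the law
of the history dominates the corresponding weighted sum over all sign sequences. -/
theorem sum_signWeight_mul_le_lintegral {w : A → Bool → ℝ} (hw : ∀ x b, 0 ≤ w x b)
    (hν : ∀ n h x (f : D → ℝ≥0∞), Measurable f →
      ∑ b, ENNReal.ofReal (w x b) * f (pt x b) ≤ ∫⁻ y, f y ∂ν.out n (h, x))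
    (n : ℕ) {f : (Fin n → A × D) → ℝ≥0∞} (hf : Measurable f) :
    ∑ s, ENNReal.ofReal (signWeight φ pt w n s) * f (signHistory φ pt n s) ≤
      ∫⁻ h, f h ∂historyLaw φ ν n := by
  induction n with
  | zero => simp [signWeight, signHistory, historyLaw, lintegral_dirac' _ hf]
  | succ n ih =>
    have hm := measurable_snoc_pair (A := A) (D := D) n
    rw [lintegral_historyLaw_succ φ ν n hf, sum_sign_succ]
    have hg : Measurable fun h : Fin n → A × D =>
        ∫⁻ y, f (Fin.snoc h (φ.act n h, y)) ∂ν.out n (h, φ.act n h) := by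
      have h1 : Measurable fun h : Fin n → A × D =>
          ∫⁻ z, f (Fin.snoc h z) ∂roundKernel φ ν n h :=
        (hf.comp hm).lintegral_kernel_prod_right'
      convert h1 using 2 with h
      rw [roundKernel_apply, lintegral_map _ measurable_prodMk_left]
      exact (hf.comp hm).comp measurable_prodMk_left
    -- The induction hypothesis is applied to the conditional expectation of `f` given the first `n`
    -- rounds.
    refine le_trans (Finset.sum_le_sum fun s _ => ?_) (ih hg)
    simp only [signWeight_snoc, signHistory_snoc]
    have h2 := hν n (signHistory φ pt n s) (signArm φ pt n s)
      (fun y => f (Fin.snoc (signHistory φ pt n s) (signArm φ pt n s, y)))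
      ((hf.comp hm).comp (measurable_prodMk_left.comp measurable_prodMk_left))
    refine le_trans (le_of_eq ?_) (mul_le_mul_right h2 _)
    rw [Finset.mul_sum]
    refine Finset.sum_congr rfl fun b _ => ?_
    rw [ENNReal.ofReal_mul (signWeight_nonneg φ pt hw n s), mul_assoc]

/-- The arm of round `n` enters the weight only at length `n + 1`. Summing out the last sign there
leaves at most the indicator of `G` at that arm. -/
theorem sum_signWeight_succ_le_historyLaw {w : A → Bool → ℝ} (hw : ∀ x b, 0 ≤ w x b)
    (hν : ∀ n h x (f : D → ℝ≥0∞), Measurable f →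
      ∑ b, ENNReal.ofReal (w x b) * f (pt x b) ≤ ∫⁻ y, f y ∂ν.out n (h, x))
    {G : Set A} (hG : MeasurableSet G) (hwG : ∀ x, ∑ b, w x b ≤ G.indicator 1 x) (n : ℕ) :
    ∑ s, signWeight φ pt w (n + 1) s ≤ (historyLaw φ ν n).real (φ.act n ⁻¹' G) := by
  have h := sum_signWeight_mul_le_lintegral φ pt ν hw hν n
    (f := (φ.act n ⁻¹' G).indicator 1) (measurable_one.indicator (φ.measurable_act n hG))
  rw [lintegral_indicator_one (φ.measurable_act n hG)] at h
  rw [sum_signWeight_succ, measureReal_def, ← ENNReal.ofReal_le_iff_le_toReal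
    (measure_ne_top _ _)]
  refine le_trans ?_ h
  rw [ENNReal.ofReal_sum_of_nonneg fun s _ => mul_nonneg (signWeight_nonneg φ pt hw n s)
    (Finset.sum_nonneg fun b _ => hw _ b)]
  refine Finset.sum_le_sum fun s _ => ?_
  rw [ENNReal.ofReal_mul (signWeight_nonneg φ pt hw n s)]
  refine mul_le_mul_right ((ENNReal.ofReal_le_ofReal (hwG _)).trans ?_) _
  by_cases hs : signArm φ pt n s ∈ G
  · have hs' : signHistory φ pt n s ∈ φ.act n ⁻¹' G := hs
    simp [hs, hs']
  · simp [hs]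

theorem signWeight_halfWeight_le (G : Set A) (n : ℕ) (s : Fin n → Bool) :
    signWeight φ pt (halfWeight G) n s ≤ (1 / 2) ^ n := by
  induction n with
  | zero => simp [signWeight]
  | succ n ih =>
    rw [pow_succ]
    refine mul_le_mul (ih _) ?_ (halfWeight_nonneg _ _ _) (by positivity)
    exact Set.indicator_le_self' (fun _ _ => by norm_num) _

theorem measurable_signWeight_halfWeight {Θ : Type*} [MeasurableSpace Θ] {G : Θ → Set A}
    (hG : ∀ x, MeasurableSet {θ | x ∈ G θ}) (n : ℕ) (s : Fin n → Bool) :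
    Measurable fun θ => signWeight φ pt (halfWeight (G θ)) n s := by
  induction n with
  | zero => exact measurable_const
  | succ n ih => exact (ih _).mul (measurable_const.indicator (hG _))

theorem integrable_signWeight_halfWeight {Θ : Type*} [MeasurableSpace Θ] (μ : Measure Θ)
    [IsFiniteMeasure μ] {G : Θ → Set A}
    (hG : ∀ x, MeasurableSet {θ | x ∈ G θ}) (n : ℕ) (s : Fin n → Bool) :
    Integrable (fun θ => signWeight φ pt (halfWeight (G θ)) n s) μ := by
  refine Integrable.of_bound (C := (1 / 2) ^ n)
    (measurable_signWeight_halfWeight φ pt hG n s).aestronglyMeasurable (.of_forall fun θ => ?_)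
  rw [Real.norm_of_nonneg (signWeight_nonneg φ pt (halfWeight_nonneg _) n s)]
  exact signWeight_halfWeight_le φ pt _ n s

/-- If every arm is outside the random set `G θ` with probability at most `ε`, then with
uniformly random signs all the first `n` arms are in `G θ` with probability at least `1 - n ε`. -/
theorem one_sub_mul_le_integral_sum_signWeight {Θ : Type*} [MeasurableSpace Θ] (μ : Measure Θ)
    [IsProbabilityMeasure μ] {G : Θ → Set A} (hG : ∀ x, MeasurableSet {θ | x ∈ G θ}) {ε : ℝ}
    (hε : ∀ x, μ.real {θ | x ∉ G θ} ≤ ε) (n : ℕ) :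
    1 - n * ε ≤ ∫ θ, ∑ s, signWeight φ pt (halfWeight (G θ)) n s ∂μ := by
  have hint := integrable_signWeight_halfWeight φ pt μ hG
  induction n with
  | zero => simp [signWeight]
  | succ n ih =>
    rw [integral_finsetSum _ fun s _ => hint _ s] at ih
    have hmc : ∀ x, MeasurableSet {θ | x ∉ G θ} := fun x => (hG x).compl
    have hi : ∀ x, Integrable ({θ | x ∉ G θ}.indicator fun _ : Θ => (1 / 2 : ℝ) ^ n) μ :=
      fun x => (integrable_const _).indicator (hmc x)
    -- For fixed signs `s` the next arm does not depend on `θ`, so the hypothesis on single arms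
    -- applies to it; the weight lost is at most `(1 / 2) ^ n` on an event of probability at most
    -- `ε`.
    have hstep : ∀ s, ∫ θ, signWeight φ pt (halfWeight (G θ)) n s ∂μ - (1 / 2) ^ n * ε ≤
        ∫ θ, signWeight φ pt (halfWeight (G θ)) n s *
          ∑ b, halfWeight (G θ) (signArm φ pt n s) b ∂μ := by
      intro s
      have h1 : ∫ θ, {θ | signArm φ pt n s ∉ G θ}.indicator (fun _ => (1 / 2 : ℝ) ^ n) θ ∂μ ≤
          (1 / 2) ^ n * ε := by
        rw [integral_indicator (hmc _)]
        simp only [integral_const, measureReal_restrict_apply_univ, smul_eq_mul]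
        rw [mul_comm]
        exact mul_le_mul_of_nonneg_left (hε _) (by positivity)
      refine (sub_le_sub_left h1 _).trans ?_
      rw [← integral_sub (hint n s) (hi _)]
      refine integral_mono ((hint n s).sub (hi _)) ?_ fun θ => ?_
      · refine (hint n s).mul_bdd (c := 1) ?_ (.of_forall fun θ => ?_)
        · exact (Finset.measurable_sum _ fun b _ =>
            measurable_const.indicator (hG _)).aestronglyMeasurable
        · by_cases hx : signArm φ pt n s ∈ G θ <;> simp [halfWeight, hx]
      · have := signWeight_halfWeight_le φ pt (G θ) n s
        by_cases hx : signArm φ pt n s ∈ G θ <;> simp [halfWeight, hx]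
        simpa [halfWeight] using this
    simp only [sum_signWeight_succ]
    rw [integral_finsetSum]
    -- The `2 ^ n` sign sequences lose `(1 / 2) ^ n * ε` each, hence `ε` altogether.
    · calc 1 - ((n + 1 : ℕ) : ℝ) * ε = 1 - n * ε - ∑ _s : Fin n → Bool, (1 / 2) ^ n * ε := by
            simp only [Finset.sum_const, Finset.card_univ, Fintype.card_fun, Fintype.card_bool,
              Fintype.card_fin, nsmul_eq_mul]
            push_cast
            rw [← mul_assoc, ← mul_pow]
            norm_num
            ring
        _ ≤ _ := by
          refine (sub_le_sub_right ih _).trans ?_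
          rw [← Finset.sum_sub_distrib]
          exact Finset.sum_le_sum fun s _ => hstep s
    · intro s _
      refine (hint n s).mul_bdd (c := 1) ?_ (.of_forall fun θ => ?_)
      · exact (Finset.measurable_sum _ fun b _ =>
          measurable_const.indicator (hG _)).aestronglyMeasurable
      · by_cases hx : signArm φ pt n s ∈ G θ <;> simp [halfWeight, hx]

end SignHistories

/-! ### Kernels supported on two points -/

section TwoPointKernel

variable {A D : Type*} [MeasurableSpace A] [MeasurableSpace D]

/-- The sign `1` or `-1` of a Boolean. -/
def boolSign (b : Bool) : ℝ := if b then 1 else -1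

/-- The kernel giving the points `y x true` and `y x false` the probabilities `(1 + q x) / 2` and
`(1 - q x) / 2`. -/
def twoPointKernel (q : A → ℝ) (y : A → Bool → D) (hq : Measurable q)
    (hy : ∀ b, Measurable fun x => y x b) : Kernel A D where
  toFun x := ∑ b, ENNReal.ofReal ((1 + boolSign b * q x) / 2) • Measure.dirac (y x b)
  measurable' := by
    refine Measure.measurable_of_measurable_coe _ fun s hs => ?_
    simp only [Fintype.sum_bool, Measure.add_apply, Measure.smul_apply, smul_eq_mul]
    have h : ∀ b, Measurable fun x =>
        ENNReal.ofReal ((1 + boolSign b * q x) / 2) * Measure.dirac (y x b) s := fun b =>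
      Measurable.mul (by fun_prop) ((Measure.measurable_coe hs).comp
        (Measure.measurable_dirac.comp (hy b)))
    exact (h _).add (h _)

variable {q : A → ℝ} {y : A → Bool → D} {hq : Measurable q} {hy : ∀ b, Measurable fun x => y x b}

theorem twoPointKernel_apply (x : A) : twoPointKernel q y hq hy x =
    ∑ b, ENNReal.ofReal ((1 + boolSign b * q x) / 2) • Measure.dirac (y x b) := rfl

theorem isMarkovKernel_twoPointKernel (h : ∀ x, |q x| ≤ 1) :
    IsMarkovKernel (twoPointKernel q y hq hy) := by
  refine ⟨fun x => ⟨?_⟩⟩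
  have := abs_le.1 (h x)
  simp only [twoPointKernel_apply, Fintype.sum_bool, Measure.add_apply, Measure.smul_apply,
    smul_eq_mul, measure_univ, mul_one, boolSign]
  rw [← ENNReal.ofReal_add]
  · simp; ring_nf
  · simp; linarith
  · simp; linarith

theorem lintegral_twoPointKernel (x : A) {f : D → ℝ≥0∞} (hf : Measurable f) :
    ∫⁻ z, f z ∂twoPointKernel q y hq hy x =
      ∑ b, ENNReal.ofReal ((1 + boolSign b * q x) / 2) * f (y x b) := by
  simp [twoPointKernel_apply, lintegral_add_measure, lintegral_dirac' _ hf]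

theorem integral_twoPointKernel [MeasurableSingletonClass D] {E : Type*} [NormedAddCommGroup E]
    [NormedSpace ℝ E] [CompleteSpace E] (x : A) (hx : |q x| ≤ 1) (f : D → E) :
    ∫ z, f z ∂twoPointKernel q y hq hy x =
      ∑ b, ((1 + boolSign b * q x) / 2) • f (y x b) := by
  have := abs_le.1 hx
  have hi : ∀ b, Integrable f
      (ENNReal.ofReal ((1 + boolSign b * q x) / 2) • Measure.dirac (y x b)) := fun b =>
    (integrable_dirac (by simp)).smul_measure ENNReal.ofReal_ne_top
  rw [twoPointKernel_apply, Fintype.sum_bool, integral_add_measure (hi _) (hi _)]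
  simp only [integral_smul_measure, integral_dirac, Fintype.sum_bool]
  rw [ENNReal.toReal_ofReal, ENNReal.toReal_ofReal]
  · simp [boolSign]; linarith
  · simp [boolSign]; linarith

end TwoPointKernel

/-! ### Geometry of arms, hypotheses and outcomes -/

section Geometry

/-- The cosine of the angle between the unit vectors `θ` and `x`. -/
def along (θ x : EuclideanSpace ℝ (Fin 2)) : ℝ := θ 0 * x 0 + θ 1 * x 1

/-- The cosine of the angle between the unit vectors `θ` and `(x 1, -x 0)`. -/
def across (θ x : EuclideanSpace ℝ (Fin 2)) : ℝ := θ 0 * x 1 - θ 1 * x 0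

/-- The coordinates of the vector `(I + l x xᵗ) θ`, which is orthogonal to all mean outcomes. -/
def normal (l : ℝ) (θ x : EuclideanSpace ℝ (Fin 2)) (i : Fin 2) : ℝ := θ i + l * along θ x * x i

theorem F_apply (l : ℝ) (x θ : EuclideanSpace ℝ (Fin 2)) (y : EuclideanSpace ℝ (Fin 3)) :
    F l x θ y = normal l θ x 0 * y 0 + normal l θ x 1 * y 1 := by
  simp [F, normal, along, Matrix.mulVec, dotProduct, Fin.sum_univ_two, Matrix.vecMulVec_apply,
    Matrix.one_apply]
  ring

theorem sq_add_sq_of_norm_eq_one {x : EuclideanSpace ℝ (Fin 2)} (hx : ‖x‖ = 1) :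
    x 0 ^ 2 + x 1 ^ 2 = 1 := by
  have := EuclideanSpace.real_norm_sq_eq x
  rw [hx, Fin.sum_univ_two] at this
  linarith

/-- The inner product of `θ` with the normal is `1 + l (along θ x)² > 0`. -/
theorem normal_sq_pos {l : ℝ} (hl : 0 ≤ l) {θ : EuclideanSpace ℝ (Fin 2)} (hθ : ‖θ‖ = 1)
    (x : EuclideanSpace ℝ (Fin 2)) : 0 < normal l θ x 0 ^ 2 + normal l θ x 1 ^ 2 := by
  by_contra! h
  have h0 : normal l θ x 0 = 0 := by
    nlinarith [sq_nonneg (normal l θ x 0), sq_nonneg (normal l θ x 1)]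
  have h1 : normal l θ x 1 = 0 := by
    nlinarith [sq_nonneg (normal l θ x 0), sq_nonneg (normal l θ x 1)]
  have h2 : θ 0 * normal l θ x 0 + θ 1 * normal l θ x 1 = 1 + l * along θ x ^ 2 := by
    rw [← sq_add_sq_of_norm_eq_one hθ]; unfold normal along; ring
  rw [h0, h1] at h2
  nlinarith [mul_nonneg hl (sq_nonneg (along θ x))]

theorem convex_outcomes : Convex ℝ Outcomes := by
  rintro y ⟨hy2, hy⟩ z ⟨hz2, hz⟩ a b ha hb hab
  refine ⟨by simp [hy2, hz2, hab], ?_⟩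
  simp only [PiLp.add_apply, PiLp.smul_apply, smul_eq_mul]
  obtain rfl : b = 1 - a := by linarith
  nlinarith [mul_nonneg ha hb, sq_nonneg (y 0 - z 0), sq_nonneg (y 1 - z 1),
    mul_nonneg (mul_nonneg ha hb) (sq_nonneg (y 0 - z 0)),
    mul_nonneg (mul_nonneg ha hb) (sq_nonneg (y 1 - z 1)),
    mul_le_mul_of_nonneg_left hy ha, mul_le_mul_of_nonneg_left hz hb]

theorem abs_reward_le (α : ℝ) (x : Arms α) (y : Outcomes) : |reward α x y| ≤ 1 := by
  obtain ⟨y, hy2, hy⟩ := y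
  rw [reward, abs_neg, ← sq_le_one_iff_abs_le_one]
  nlinarith [sq_nonneg (y 1)]

theorem measurable_reward (α : ℝ) : Measurable (Function.uncurry (reward α)) := by
  have : Continuous (Function.uncurry (reward α)) := by
    unfold reward Function.uncurry; fun_prop
  exact this.measurable

/-- The outcome with given coordinates in the unit disk. -/
def mkOutcome (u v : ℝ) (h : u ^ 2 + v ^ 2 ≤ 1) : Outcomes := ⟨!₂[u, v, 1], by simp [Outcomes, h]⟩

theorem measurable_mkOutcome {X : Type*} [MeasurableSpace X] {u v : X → ℝ}
    (h : ∀ x, u x ^ 2 + v x ^ 2 ≤ 1) (hu : Measurable u) (hv : Measurable v) :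
    Measurable fun x => mkOutcome (u x) (v x) (h x) := by
  refine Measurable.subtype_mk ((WithLp.measurable_toLp 2 _).comp (measurable_pi_iff.2 fun i => ?_))
  fin_cases i
  · exact hu
  · exact hv
  · exact measurable_const

/-- The worst mean outcome under the hypothesis `θ` for the arm `x`. -/
def worstOutcome (l : ℝ) (θ x : EuclideanSpace ℝ (Fin 2)) : Outcomes :=
  mkOutcome (|normal l θ x 1| / √(normal l θ x 0 ^ 2 + normal l θ x 1 ^ 2))
    (-(SignType.sign (normal l θ x 1) : ℝ) * normal l θ x 0 /
      √(normal l θ x 0 ^ 2 + normal l θ x 1 ^ 2)) (by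
    have h0 : 0 ≤ normal l θ x 0 ^ 2 + normal l θ x 1 ^ 2 := by positivity
    rw [div_pow, div_pow, Real.sq_sqrt h0, ← add_div, mul_pow, sq_abs, neg_sq]
    refine div_le_one_of_le₀ ?_ h0
    have : ((SignType.sign (normal l θ x 1) : SignType) : ℝ) ^ 2 ≤ 1 := by
      cases SignType.sign (normal l θ x 1) <;> simp
    nlinarith [mul_le_mul_of_nonneg_right this (sq_nonneg (normal l θ x 0))])

/-- The points `(x' ± x) / √2` of the unit circle, where `x' = (x 1, -x 0)`. -/
def signOutcome (α : ℝ) (x : Arms α) (b : Bool) : Outcomes :=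
  mkOutcome ((x.1 1 + boolSign b * x.1 0) / √2) ((-x.1 0 + boolSign b * x.1 1) / √2) (by
    have := sq_add_sq_of_norm_eq_one x.2.1
    rw [div_pow, div_pow, Real.sq_sqrt (by norm_num)]
    cases b <;> simp [boolSign] <;> nlinarith)

theorem F_worstOutcome (l : ℝ) (θ x : EuclideanSpace ℝ (Fin 2)) :
    F l x θ (worstOutcome l θ x) = 0 := by
  rw [F_apply]
  -- Writing the absolute value as sign times value makes the terms cancel, also when `normal l θ x
  -- 1 = 0` and the sign is `0`.
  simp only [worstOutcome, mkOutcome]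
  simp only [Matrix.cons_val_zero, Matrix.cons_val_one]
  rw [← sign_mul_self (normal l θ x 1)]
  ring

/-- The arms for which the hypothesis `θ` is hard to distinguish from the others. -/
def farArms (α l T : ℝ) (θ : EuclideanSpace ℝ (Fin 2)) : Set (Arms α) :=
  {x | |across θ x| ≤ T * (l + 1) * |along θ x|}

/-- The bias of the sign of the outcome under the hypothesis `θ`. -/
def tilt (l : ℝ) (θ x : EuclideanSpace ℝ (Fin 2)) : ℝ := -across θ x / ((l + 1) * along θ x)

theorem abs_tilt_le {α l T : ℝ} (hl : 0 < l) (hT : 0 ≤ T) {θ : EuclideanSpace ℝ (Fin 2)}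
    {x : Arms α} (hx : x ∈ farArms α l T θ) : |tilt l θ x| ≤ T := by
  rw [tilt, abs_div, abs_neg, abs_mul, abs_of_pos (by linarith : 0 < l + 1)]
  refine div_le_of_le_mul₀ (by positivity) hT ?_
  rw [← mul_assoc]; exact hx

theorem measurableSet_farArms (α l T : ℝ) (θ : EuclideanSpace ℝ (Fin 2)) :
    MeasurableSet (farArms α l T θ) := by
  refine (isClosed_le ?_ ?_).measurableSet <;> simp only [across, along] <;> fun_prop

end Geometry

/-! ### Nature's policy: compatibility and reward -/

section Nature

/-- The vectors `x` and `x' = (x 1, -x 0)` are eigenvectors of `I + l x xᵗ` for `l + 1` and `1`, and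
their inner products with `θ` are `along` and `across`. -/
theorem F_signOutcome {α : ℝ} (l : ℝ) (θ : EuclideanSpace ℝ (Fin 2)) (x : Arms α)
    (b : Bool) :
    F l x θ (signOutcome α x b) = (across θ x + boolSign b * ((l + 1) * along θ x)) / √2 := by
  have h := sq_add_sq_of_norm_eq_one x.2.1
  rw [F_apply]
  simp only [signOutcome, mkOutcome, normal, Matrix.cons_val_zero, Matrix.cons_val_one]
  rw [mul_div_assoc', mul_div_assoc', ← add_div]
  congr 1
  simp only [across, along]
  linear_combination (l * (θ 0 * x.1 0 + θ 1 * x.1 1) * boolSign b) * h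

/-- The bias of nature's choice between its two outcomes for the arm `x`. -/
def outBias (α l T : ℝ) (θ : EuclideanSpace ℝ (Fin 2)) : Arms α → ℝ :=
  (farArms α l T θ).indicator fun x => tilt l θ x

open Classical in
/-- Nature's two outcomes for the arm `x`. -/
def outPoint (α l T : ℝ) (θ : EuclideanSpace ℝ (Fin 2)) (x : Arms α) (b : Bool) : Outcomes :=
  if x ∈ farArms α l T θ then signOutcome α x b else worstOutcome l θ x

theorem measurable_coord (α : ℝ) (i : Fin 2) : Measurable fun x : Arms α => x.1 i :=
  Continuous.measurable (by fun_prop)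

theorem measurable_along (α : ℝ) (θ : EuclideanSpace ℝ (Fin 2)) :
    Measurable fun x : Arms α => along θ x :=
  Continuous.measurable (by simp only [along]; fun_prop)

theorem measurable_outBias (α l T : ℝ) (θ : EuclideanSpace ℝ (Fin 2)) :
    Measurable (outBias α l T θ) := by
  refine Measurable.indicator ?_ (measurableSet_farArms α l T θ)
  have : Measurable fun x : Arms α => across θ x :=
    Continuous.measurable (by simp only [across]; fun_prop)
  exact this.neg.div ((measurable_along α θ).const_mul _)

theorem measurable_outPoint (α l T : ℝ) (θ : EuclideanSpace ℝ (Fin 2)) (b : Bool) :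
    Measurable fun x => outPoint α l T θ x b := by
  have h0 := measurable_coord α 0
  have h1 := measurable_coord α 1
  have hn : ∀ i, Measurable fun x : Arms α => normal l θ x i := fun i =>
    (((measurable_along α θ).const_mul l).mul (measurable_coord α i)).const_add _
  have hsq : Measurable fun x : Arms α => √(normal l θ x 0 ^ 2 + normal l θ x 1 ^ 2) :=
    (((hn 0).pow_const 2).add ((hn 1).pow_const 2)).sqrt
  have hs : Measurable fun r : ℝ => ((SignType.sign r : SignType) : ℝ) := by
    have h : Measurable fun r : ℝ => if 0 < r then (1 : ℝ) else if r < 0 then -1 else 0 :=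
      Measurable.ite measurableSet_Ioi measurable_const
        (Measurable.ite measurableSet_Iio measurable_const measurable_const)
    convert h using 2 with r
    rw [sign_apply]
    split_ifs <;> simp
  refine Measurable.ite (measurableSet_farArms α l T θ) ?_ ?_
  · exact measurable_mkOutcome _ ((h1.add (h0.const_mul _)).div_const _)
      ((h0.neg.add (h1.const_mul _)).div_const _)
  · exact measurable_mkOutcome _ ((hn 1).abs.div hsq)
      (((hs.comp (hn 1)).neg.mul (hn 0)).div hsq)

theorem abs_outBias_le {α l T : ℝ} (hl : 0 < l) (hT : 0 ≤ T) (θ : EuclideanSpace ℝ (Fin 2))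
    (x : Arms α) : |outBias α l T θ x| ≤ T := by
  unfold outBias
  by_cases hx : x ∈ farArms α l T θ
  · rw [Set.indicator_of_mem hx]; exact abs_tilt_le hl hT hx
  · rw [Set.indicator_of_notMem hx]; simpa using hT

/-- Nature's choice of outcome: in a far arm one of the two points `signOutcome`, with the bias
required by `θ`; otherwise the worst mean outcome. -/
def outKernel (α l T : ℝ) (θ : EuclideanSpace ℝ (Fin 2)) : Kernel (Arms α) Outcomes :=
  twoPointKernel (outBias α l T θ) (outPoint α l T θ) (measurable_outBias α l T θ)
    (measurable_outPoint α l T θ)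

theorem integral_outKernel {α l T : ℝ} (hl : 0 < l) (hT : 0 ≤ T) (hT1 : T ≤ 1)
    (θ : EuclideanSpace ℝ (Fin 2)) (x : Arms α) {E : Type*} [NormedAddCommGroup E]
    [NormedSpace ℝ E] [CompleteSpace E] (f : Outcomes → E) :
    ∫ y, f y ∂outKernel α l T θ x =
      ∑ b, ((1 + boolSign b * outBias α l T θ x) / 2) • f (outPoint α l T θ x b) :=
  integral_twoPointKernel x ((abs_outBias_le hl hT θ x).trans hT1) f

theorem isMarkovKernel_outKernel {α l T : ℝ} (hl : 0 < l) (hT : 0 ≤ T) (hT1 : T ≤ 1)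
    (θ : EuclideanSpace ℝ (Fin 2)) : IsMarkovKernel (outKernel α l T θ) :=
  isMarkovKernel_twoPointKernel fun x => (abs_outBias_le hl hT θ x).trans hT1

/-- In a far arm the mean of `F` is `(across + q (l + 1) along) / √2` with bias `q`, and `tilt` is
the root of this in `q`. The mean stays in the disk by convexity. -/
theorem integral_outKernel_mem {α l T : ℝ} (hl : 0 < l) (hT : 0 ≤ T) (hT1 : T ≤ 1)
    (θ : EuclideanSpace ℝ (Fin 2)) (x : Arms α) :
    ∫ y : Outcomes, (y : EuclideanSpace ℝ (Fin 3)) ∂outKernel α l T θ x ∈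
      (LinearMap.ker (F l x θ) : Set (EuclideanSpace ℝ (Fin 3))) ∩ Outcomes := by
  have hq := abs_le.1 ((abs_outBias_le hl hT θ x).trans hT1)
  rw [integral_outKernel hl hT hT1]
  constructor
  · rw [SetLike.mem_coe, LinearMap.mem_ker, map_sum]
    simp only [map_smul, Fintype.sum_bool, smul_eq_mul]
    by_cases hx : x ∈ farArms α l T θ
    · simp only [outPoint, if_pos hx, F_signOutcome, outBias, Set.indicator_of_mem hx, tilt,
        boolSign]
      have hl1 : l + 1 ≠ 0 := by linarith
      -- Here `tilt` is `0` by division by zero, but being far then forces `across θ x = 0`, so the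
      -- constraint still holds.
      by_cases hs : along θ x = 0
      · have h0 : across θ x = 0 := by simpa [farArms, hs] using hx
        simp [hs, h0]
      · simp
        field_simp
        ring
    · simp [outPoint, if_neg hx, F_worstOutcome]
  · refine convex_outcomes.sum_mem (fun b _ => ?_) ?_ fun b _ => Subtype.coe_prop _
    · cases b <;> simp [boolSign] <;> linarith
    · simp [boolSign]; ring

/-- The nature policy which samples the outcomes from `outKernel`, ignoring the past. -/
def naturePolicy (α l T : ℝ) (hl : 0 < l) (hT : 0 ≤ T) (hT1 : T ≤ 1)
    (θ : EuclideanSpace ℝ (Fin 2)) : NaturePolicy (hyp α l θ) where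
  out n := Kernel.prodMkLeft (Fin n → Arms α × Outcomes) (outKernel α l T θ)
  markov n := by
    have := isMarkovKernel_outKernel (α := α) hl hT hT1 θ
    infer_instance
  compatible n h x := integral_outKernel_mem hl hT hT1 θ x

theorem naturePolicy_out {α l T : ℝ} (hl : 0 < l) (hT : 0 ≤ T) (hT1 : T ≤ 1)
    (θ : EuclideanSpace ℝ (Fin 2)) (n : ℕ) (h : Fin n → Arms α × Outcomes) (x : Arms α) :
    (naturePolicy α l T hl hT hT1 θ).out n (h, x) = outKernel α l T θ x := rfl

theorem integral_reward_eq {α : ℝ} (x : Arms α) (ζ : ProbabilityMeasure Outcomes) :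
    ∫ y, reward α x y ∂(ζ : Measure Outcomes) =
      -(∫ y : Outcomes, (y : EuclideanSpace ℝ (Fin 3)) ∂(ζ : Measure Outcomes)) 0 := by
  have hi : Integrable (fun y : Outcomes => (y : EuclideanSpace ℝ (Fin 3)))
      (ζ : Measure Outcomes) := by
    refine Integrable.of_bound (C := 2) measurable_subtype_coe.aestronglyMeasurable
      (.of_forall fun y => ?_)
    refine abs_le_of_sq_le_sq' ?_ (by norm_num) |>.2
    rw [EuclideanSpace.real_norm_sq_eq, Fin.sum_univ_three, y.2.1]
    linarith [y.2.2]
  have := (EuclideanSpace.proj (𝕜 := ℝ) (0 : Fin 3)).integral_comp_comm hi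
  rw [show ∀ v : EuclideanSpace ℝ (Fin 3), v 0 = EuclideanSpace.proj (𝕜 := ℝ) (0 : Fin 3) v from
    fun _ => rfl, ← this, ← integral_neg]
  rfl

theorem worstOutcome_zero (l : ℝ) (θ x : EuclideanSpace ℝ (Fin 2)) :
    (worstOutcome l θ x).1 0 =
      |normal l θ x 1| / √(normal l θ x 0 ^ 2 + normal l θ x 1 ^ 2) := rfl

/-- With normal `(n₀, n₁)`, orthogonality gives `n₀² y₀² = n₁² y₁² ≤ n₁² (1 - y₀²)`, that is `y₀²
(n₀² + n₁²) ≤ n₁²`. -/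
theorem coord_le_worstOutcome {l : ℝ} (hl : 0 ≤ l) {θ : EuclideanSpace ℝ (Fin 2)} (hθ : ‖θ‖ = 1)
    (x : EuclideanSpace ℝ (Fin 2)) {y : EuclideanSpace ℝ (Fin 3)} (hy : y ∈ Outcomes)
    (hF : F l x θ y = 0) : y 0 ≤ (worstOutcome l θ x).1 0 := by
  have hpos := normal_sq_pos hl hθ x
  rw [F_apply] at hF
  rw [worstOutcome_zero, le_div_iff₀ (Real.sqrt_pos.2 hpos)]
  refine (le_abs_self _).trans (sq_le_sq.1 ?_)
  rw [mul_pow, Real.sq_sqrt hpos.le]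
  have h1 : (normal l θ x 0 * y 0) ^ 2 = (normal l θ x 1 * y 1) ^ 2 := by
    rw [eq_neg_of_add_eq_zero_left hF]; ring
  nlinarith [mul_le_mul_of_nonneg_left hy.2 (sq_nonneg (normal l θ x 1))]

/-- The lower prevision is attained at the worst mean outcome. -/
theorem lowerPrevision_hyp {α l : ℝ} (hl : 0 < l) {θ : EuclideanSpace ℝ (Fin 2)} (hθ : ‖θ‖ = 1)
    (x : Arms α) :
    lowerPrevision (reward α) (hyp α l θ) x = -(worstOutcome l θ x).1 0 := by
  have hζ : (⟨Measure.dirac (worstOutcome l θ x), inferInstance⟩ : ProbabilityMeasure Outcomes) ∈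
      hyp α l θ x := by
    have : ∫ y : Outcomes, (y : EuclideanSpace ℝ (Fin 3)) ∂Measure.dirac (worstOutcome l θ x) =
        worstOutcome l θ x := integral_dirac _ _
    refine ⟨?_, ?_⟩
    · rw [SetLike.mem_coe, LinearMap.mem_ker]
      exact this ▸ F_worstOutcome l θ x
    · exact this ▸ Subtype.coe_prop _
  have : Nonempty (hyp α l θ x) := ⟨⟨_, hζ⟩⟩
  have hlow : ∀ ζ : hyp α l θ x, -(worstOutcome l θ x).1 0 ≤
      ∫ y, reward α x y ∂((ζ : ProbabilityMeasure Outcomes) : Measure Outcomes) := fun ζ => by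
    rw [integral_reward_eq]
    exact neg_le_neg (coord_le_worstOutcome hl.le hθ x ζ.2.2 ζ.2.1)
  refine le_antisymm ?_ (le_ciInf hlow)
  refine (ciInf_le ⟨_, by rintro _ ⟨ζ, rfl⟩; exact hlow ζ⟩ ⟨_, hζ⟩).trans_eq ?_
  exact integral_dirac _ _

theorem lowerPrevision_le_ciSup {α l : ℝ} (hl : 0 < l) {θ : EuclideanSpace ℝ (Fin 2)}
    (hθ : ‖θ‖ = 1) (x : Arms α) :
    lowerPrevision (reward α) (hyp α l θ) x ≤
      ⨆ x : Arms α, lowerPrevision (reward α) (hyp α l θ) x := by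
  refine le_ciSup ⟨0, ?_⟩ x
  rintro _ ⟨x, rfl⟩
  simp only [lowerPrevision_hyp hl hθ, worstOutcome_zero]
  have : 0 ≤ |normal l θ x 1| / √(normal l θ x 0 ^ 2 + normal l θ x 1 ^ 2) := by positivity
  linarith

/-- The witness is the arm orthogonal to `θ`: its normal is `θ` itself, so its lower prevision is
`-|θ 1|`. -/
theorem neg_cos_le_ciSup_lowerPrevision {α l : ℝ} (hl : 0 < l) {θ : EuclideanSpace ℝ (Fin 2)}
    (hθ : θ ∈ Params α) :
    -Real.cos α ≤ ⨆ x : Arms α, lowerPrevision (reward α) (hyp α l θ) x := by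
  have hsq := sq_add_sq_of_norm_eq_one hθ.1
  have hx : (!₂[-θ 1, θ 0] : EuclideanSpace ℝ (Fin 2)) ∈ Arms α := by
    refine ⟨?_, hθ.2.1, by simpa using hθ.2.2⟩
    rw [EuclideanSpace.norm_eq]
    simp [Fin.sum_univ_two]
    linarith
  refine le_trans ?_ (lowerPrevision_le_ciSup hl hθ.1 ⟨_, hx⟩)
  have h0 : along θ !₂[-θ 1, θ 0] = 0 := by simp [along]; ring
  rw [lowerPrevision_hyp hl hθ.1, worstOutcome_zero]
  simp only [normal, h0, mul_zero, zero_mul, add_zero, hsq, Real.sqrt_one, div_one]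
  exact neg_le_neg hθ.2.2

theorem cos_three_pi_div_eight_le : Real.cos (3 / 8 * Real.pi) ≤ 2 / 5 := by
  rw [show 3 / 8 * Real.pi = Real.pi / 2 - Real.pi / 8 by ring, Real.cos_pi_div_two_sub,
    Real.sin_pi_div_eight]
  have h2 : (1.36 : ℝ) ≤ √2 := Real.le_sqrt_of_sq_le (by norm_num)
  have : √(2 - √2) ≤ 4 / 5 := by
    rw [Real.sqrt_le_left (by norm_num)]
    norm_num; linarith
  linarith

/-- The mean reward of a round is at most the optimal value, and worse by a constant if the arm
is far. -/
theorem integral_reward_outKernel_le {α l T : ℝ}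
    (hα : α ∈ Set.Ioo (3 / 8 * Real.pi) (1 / 2 * Real.pi)) (hl : 0 < l) (hT : 0 ≤ T)
    (hT1 : T ≤ 1 / 4) {θ : EuclideanSpace ℝ (Fin 2)} (hθ : θ ∈ Params α) (x : Arms α) :
    ∫ y, reward α x y ∂outKernel α l T θ x ≤
      (⨆ x : Arms α, lowerPrevision (reward α) (hyp α l θ) x) - (farArms α l T θ).indicator
        (fun _ => Real.cos (3 / 8 * Real.pi) - Real.cos α) x := by
  rw [integral_outKernel hl hT (by linarith)]
  simp only [Fintype.sum_bool, smul_eq_mul, reward]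
  by_cases hx : x ∈ farArms α l T θ
  · have hS := neg_cos_le_ciSup_lowerPrevision hl hθ
    rw [Set.indicator_of_mem hx]
    suffices Real.cos (3 / 8 * Real.pi) ≤ (x.1 1 + outBias α l T θ x * x.1 0) / √2 by
      simp only [outPoint, if_pos hx, signOutcome, mkOutcome, Matrix.cons_val_zero, boolSign]
      refine le_trans (le_of_eq ?_) (show -((x.1 1 + outBias α l T θ x * x.1 0) / √2) ≤ _ by
        linarith)
      simp
      ring
    -- Far arms have `x 1 ≥ 9/10` and a bias term of at most `1/10`, so the mean of `y 0` is at
    -- least `(4/5) / √2 ≥ 2/5`.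
    refine cos_three_pi_div_eight_le.trans ?_
    have hb := (abs_outBias_le hl hT θ x).trans hT1
    have hcos : Real.cos α ≤ 2 / 5 := le_trans (Real.cos_le_cos_of_nonneg_of_le_pi
      (by positivity) (by linarith [hα.2, Real.pi_pos]) hα.1.le) cos_three_pi_div_eight_le
    have hx0 : |x.1 0| ≤ 2 / 5 := x.2.2.2.trans hcos
    have hx1 : 9 / 10 ≤ x.1 1 := by
      have h1 := sq_add_sq_of_norm_eq_one x.2.1
      have h2 : x.1 0 ^ 2 ≤ (2 / 5) ^ 2 := sq_le_sq' (abs_le.1 hx0).1 (abs_le.1 hx0).2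
      nlinarith [x.2.2.1]
    have hprod : |outBias α l T θ x * x.1 0| ≤ 1 / 4 * (2 / 5) := by
      rw [abs_mul]; exact mul_le_mul hb hx0 (abs_nonneg _) (by norm_num)
    have h2 : √2 ≤ 2 := by
      rw [Real.sqrt_le_left (by norm_num)]; norm_num
    rw [le_div_iff₀ (by positivity)]
    linarith [(abs_le.1 hprod).1]
  -- Outside the far arms both points are the worst outcome, so the mean reward is exactly the lower
  -- prevision of `x`.
  · rw [Set.indicator_of_notMem hx, sub_zero]
    refine le_trans (le_of_eq ?_) (lowerPrevision_le_ciSup hl hθ.1 x)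
    rw [lowerPrevision_hyp hl hθ.1]
    simp only [outPoint, if_neg hx, outBias, Set.indicator_of_notMem hx]
    ring

end Nature

/-! ### True signs against fair signs -/

section LowerBound

theorem sum_le_regret {α l T : ℝ} (hα : α ∈ Set.Ioo (3 / 8 * Real.pi) (1 / 2 * Real.pi))
    (hl : 0 < l) (hT : 0 ≤ T) (hT1 : T ≤ 1 / 4) {θ : EuclideanSpace ℝ (Fin 2)}
    (hθ : θ ∈ Params α) (φ : AgentPolicy (Arms α) Outcomes) (N : ℕ) :
    (Real.cos (3 / 8 * Real.pi) - Real.cos α) * ∑ n ∈ Finset.range N,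
      (historyLaw φ (naturePolicy α l T hl hT (by linarith) θ) n).real
        (φ.act n ⁻¹' farArms α l T θ) ≤ regret α l θ φ N := by
  have h1 := sub_totalReward_le_expectedRegret φ (naturePolicy α l T hl hT (by linarith) θ) N
    (abs_reward_le α)
  have h2 := totalReward_le φ (naturePolicy α l T hl hT (by linarith) θ) (measurable_reward α)
    (abs_reward_le α) (measurableSet_farArms α l T θ)
    (fun n h x => integral_reward_outKernel_le hα hl hT hT1 hθ x) N
  unfold regret
  linarith

/-- The probability of the sign `b` in a far arm under the hypothesis `θ`. -/
def likelihood (α l T : ℝ) (θ : EuclideanSpace ℝ (Fin 2)) (x : Arms α) (b : Bool) : ℝ :=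
  (farArms α l T θ).indicator (fun x => (1 + boolSign b * outBias α l T θ x) / 2) x

/-- A quarter of the inverse of `likelihood`. -/
def inverseLikelihood (α l T : ℝ) (θ : EuclideanSpace ℝ (Fin 2)) (x : Arms α) (b : Bool) : ℝ :=
  (farArms α l T θ).indicator (fun x => 1 / (2 * (1 + boolSign b * outBias α l T θ x))) x

theorem one_add_boolSign_mul_pos {q : ℝ} (hq : |q| < 1) (b : Bool) : 0 < 1 + boolSign b * q := by
  have := abs_lt.1 hq
  cases b <;> simp [boolSign] <;> linarith

theorem one_add_boolSign_mul_outBias_pos {α l T : ℝ} (hl : 0 < l) (hT : 0 ≤ T) (hT1 : T ≤ 1 / 4)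
    (θ : EuclideanSpace ℝ (Fin 2)) (x : Arms α) (b : Bool) :
    0 < 1 + boolSign b * outBias α l T θ x :=
  one_add_boolSign_mul_pos ((abs_outBias_le hl hT θ x).trans_lt (by linarith)) b

theorem likelihood_nonneg {α l T : ℝ} (hl : 0 < l) (hT : 0 ≤ T) (hT1 : T ≤ 1 / 4)
    (θ : EuclideanSpace ℝ (Fin 2)) (x : Arms α) (b : Bool) : 0 ≤ likelihood α l T θ x b :=
  Set.indicator_nonneg (fun x _ =>
    (div_pos (one_add_boolSign_mul_outBias_pos hl hT hT1 θ x b) two_pos).le) _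

theorem inverseLikelihood_nonneg {α l T : ℝ} (hl : 0 < l) (hT : 0 ≤ T) (hT1 : T ≤ 1 / 4)
    (θ : EuclideanSpace ℝ (Fin 2)) (x : Arms α) (b : Bool) :
    0 ≤ inverseLikelihood α l T θ x b :=
  Set.indicator_nonneg (fun x _ => by
    have := one_add_boolSign_mul_outBias_pos hl hT hT1 θ x b
    positivity) _

theorem sum_likelihood_le_historyLaw {α l T : ℝ} (hl : 0 < l) (hT : 0 ≤ T) (hT1 : T ≤ 1 / 4)
    (θ : EuclideanSpace ℝ (Fin 2)) (φ : AgentPolicy (Arms α) Outcomes) (n : ℕ) :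
    ∑ s, signWeight φ (signOutcome α) (likelihood α l T θ) (n + 1) s ≤
      (historyLaw φ (naturePolicy α l T hl hT (by linarith) θ) n).real
        (φ.act n ⁻¹' farArms α l T θ) := by
  refine sum_signWeight_succ_le_historyLaw φ (signOutcome α) _
    (likelihood_nonneg hl hT hT1 θ) (fun n h x f hf => ?_) (measurableSet_farArms α l T θ)
    (fun x => ?_) n
  · rw [naturePolicy_out, outKernel, lintegral_twoPointKernel _ hf]
    refine Finset.sum_le_sum fun b _ => ?_
    by_cases hx : x ∈ farArms α l T θ <;> simp [likelihood, outPoint, hx]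
  · by_cases hx : x ∈ farArms α l T θ <;> simp [likelihood, hx, boolSign]
    linarith

/-- In a far arm with bias `q` the two weights add up to `1 / (1 - q²)`, and `|q| ≤ T`. -/
theorem sum_inverseLikelihood_le {α l T : ℝ} (hl : 0 < l) (hT : 0 ≤ T) (hT1 : T ≤ 1 / 4)
    (θ : EuclideanSpace ℝ (Fin 2)) (φ : AgentPolicy (Arms α) Outcomes) (n : ℕ) :
    ∑ s, signWeight φ (signOutcome α) (inverseLikelihood α l T θ) n s ≤
      (1 / (1 - T ^ 2)) ^ n := by
  have hT2 : 0 < 1 - T ^ 2 := by nlinarith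
  refine sum_signWeight_le_pow φ _ (inverseLikelihood_nonneg hl hT hT1 θ) (by positivity)
    (fun x => ?_) n
  have hq := abs_outBias_le hl hT θ x
  have hq2 : outBias α l T θ x ^ 2 ≤ T ^ 2 := sq_le_sq' (abs_le.1 hq).1 (abs_le.1 hq).2
  by_cases hx : x ∈ farArms α l T θ
  · have h1 := one_add_boolSign_mul_outBias_pos hl hT hT1 θ x true
    have h2 := one_add_boolSign_mul_outBias_pos hl hT hT1 θ x false
    simp only [boolSign, if_true, Bool.false_eq_true, if_false] at h1 h2
    simp only [inverseLikelihood, Set.indicator_of_mem hx, Fintype.sum_bool, boolSign, if_true,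
      Bool.false_eq_true, if_false]
    have : 1 / (2 * (1 + 1 * outBias α l T θ x)) + 1 / (2 * (1 + -1 * outBias α l T θ x)) =
        1 / (1 - outBias α l T θ x ^ 2) := by
      have h3 : 1 - outBias α l T θ x ^ 2 ≠ 0 := by nlinarith
      rw [div_add_div _ _ (by positivity) (by positivity), div_eq_div_iff (by positivity) h3]
      ring
    rw [this]
    exact one_div_le_one_div_of_le hT2 (by linarith)
  · simp [inverseLikelihood, hx, hT2.le]

/-- The change of measure: on far arms `halfWeight² = likelihood * inverseLikelihood`, so
`two_mul_signWeight_le` applies. The loss is of second order in `T`, which is why a bias of order `1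
/ √N` stays hidden for `N` rounds. -/
theorem two_mul_sum_halfWeight_sub_le {α l T : ℝ} (hl : 0 < l) (hT : 0 ≤ T) (hT1 : T ≤ 1 / 4)
    (θ : EuclideanSpace ℝ (Fin 2)) (φ : AgentPolicy (Arms α) Outcomes) (n : ℕ) :
    2 * ∑ s, signWeight φ (signOutcome α) (halfWeight (farArms α l T θ)) n s -
      (1 / (1 - T ^ 2)) ^ n ≤ ∑ s, signWeight φ (signOutcome α) (likelihood α l T θ) n s := by
  have h1 := sum_inverseLikelihood_le hl hT hT1 θ φ n
  have h2 : ∑ s, 2 * signWeight φ (signOutcome α) (halfWeight (farArms α l T θ)) n s ≤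
      ∑ s, (signWeight φ (signOutcome α) (likelihood α l T θ) n s +
        signWeight φ (signOutcome α) (inverseLikelihood α l T θ) n s) := by
    refine Finset.sum_le_sum fun s _ => two_mul_signWeight_le φ _
      (likelihood_nonneg hl hT hT1 θ) (fun x b => ?_) (inverseLikelihood_nonneg hl hT hT1 θ) n s
    have h3 := one_add_boolSign_mul_outBias_pos hl hT hT1 θ x b
    by_cases hx : x ∈ farArms α l T θ
    · simp only [halfWeight, likelihood, inverseLikelihood, Set.indicator_of_mem hx]
      refine le_of_eq ?_
      field_simp
    · simp [halfWeight, hx, likelihood]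
  rw [← Finset.mul_sum, Finset.sum_add_distrib] at h2
  linarith

/-- Bernoulli's inequality: `(1 - T²)^N ≥ 1 - N T² ≥ 15/16`. -/
theorem pow_inv_one_sub_sq_le {T : ℝ} {N n : ℕ} (hN : 0 < N) (hn : n ≤ N)
    (hT : T ^ 2 ≤ 1 / (16 * N)) :
    (1 / (1 - T ^ 2)) ^ n ≤ 16 / 15 := by
  have hN' : (1 : ℝ) ≤ N := by exact_mod_cast hN
  have hT1 : T ^ 2 ≤ 1 / 16 := hT.trans (by
    apply one_div_le_one_div_of_le <;> linarith)
  have h1 : (1 : ℝ) ≤ 1 / (1 - T ^ 2) := by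
    rw [le_div_iff₀ (by linarith)]; nlinarith [sq_nonneg T]
  refine (pow_le_pow_right₀ h1 hn).trans ?_
  rw [div_pow, one_pow, div_le_div_iff₀ (pow_pos (by linarith) _) (by norm_num)]
  have h2 := one_add_mul_le_pow (a := -T ^ 2) (by linarith) N
  have h3 : (N : ℝ) * T ^ 2 ≤ 1 / 16 := by
    rw [le_div_iff₀ (by positivity)] at hT; linarith
  have h4 : 1 + (N : ℝ) * -T ^ 2 ≤ (1 - T ^ 2) ^ N := by simpa [sub_eq_add_neg] using h2
  linarith

end LowerBound

/-! ### The uniform distribution on the arc of hypotheses -/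

section Uniform

variable {α : ℝ}

theorem measurable_circleParam :
    Measurable fun t : ℝ => (!₂[Real.cos t, Real.sin t] : EuclideanSpace ℝ (Fin 2)) := by
  refine (WithLp.measurable_toLp 2 _).comp (measurable_pi_iff.2 fun i => ?_)
  fin_cases i
  · exact Real.measurable_cos
  · exact Real.measurable_sin

theorem volume_Icc_ne_zero (hα : α < 1 / 2 * Real.pi) :
    volume (Set.Icc (-(Real.pi / 2 - α)) (Real.pi / 2 - α)) ≠ 0 := by
  rw [Real.volume_Icc, Ne, ENNReal.ofReal_eq_zero]
  linarith

theorem isProbabilityMeasure_uniformParams (hα : α < 1 / 2 * Real.pi) :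
    IsProbabilityMeasure (uniformParams α) := by
  have := cond_isProbabilityMeasure_of_finite (volume_Icc_ne_zero hα) (by simp)
  exact Measure.isProbabilityMeasure_map measurable_circleParam.aemeasurable

theorem measurableSet_params (α : ℝ) : MeasurableSet (Params α) := by
  have h : ∀ i, Measurable fun θ : EuclideanSpace ℝ (Fin 2) => θ i := fun i =>
    Continuous.measurable (by fun_prop)
  exact (measurableSet_eq_fun measurable_norm measurable_const).inter
    ((measurableSet_lt measurable_const (h 0)).inter
      (measurableSet_le (h 1).abs measurable_const))

theorem abs_sin_le_cos {α t : ℝ} (hα : 0 ≤ α) (ht : |t| ≤ Real.pi / 2 - α) :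
    |Real.sin t| ≤ Real.cos α := by
  have h := abs_le.1 ht
  rw [← Real.sin_pi_div_two_sub, abs_le, ← Real.sin_neg]
  constructor <;> apply Real.sin_le_sin_of_le_of_le_pi_div_two <;> linarith

theorem ae_mem_params (hα : α ∈ Set.Ioo (3 / 8 * Real.pi) (1 / 2 * Real.pi)) :
    ∀ᵐ θ ∂uniformParams α, θ ∈ Params α := by
  have hπ := Real.pi_pos
  refine (ae_map_iff measurable_circleParam.aemeasurable (measurableSet_params α)).2 ?_
  refine (ae_cond_mem measurableSet_Icc).mono fun t ht => ⟨?_, ?_, ?_⟩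
  · rw [EuclideanSpace.norm_eq]; simp [Fin.sum_univ_two]
  · exact Real.cos_pos_of_mem_Ioo ⟨by linarith [ht.1, hα.1], by linarith [ht.2, hα.1]⟩
  · exact abs_sin_le_cos (by linarith [hα.1]) (abs_le.2 ht)

theorem abs_le_abs_tan {u : ℝ} (hu : |u| < Real.pi / 2) : |u| ≤ |Real.tan u| := by
  rcases le_total 0 u with h | h
  · rw [abs_of_nonneg h] at hu ⊢
    exact (Real.le_tan h hu).trans (le_abs_self _)
  · rw [abs_of_nonpos h] at hu ⊢
    have := Real.le_tan (by linarith) hu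
    rw [Real.tan_neg] at this
    exact this.trans (neg_le_abs _)

theorem measurableSet_mem_farArms (l T : ℝ) (x : Arms α) :
    MeasurableSet {θ | x ∈ farArms α l T θ} := by
  have : IsClosed {θ : EuclideanSpace ℝ (Fin 2) | |across θ x| ≤ T * (l + 1) * |along θ x|} :=
    isClosed_le (by simp only [across]; fun_prop) (by simp only [along]; fun_prop)
  exact this.measurableSet

/-- For `θ = (cos t, sin t)` and `x = (sin a, cos a)`, `along` and `across` are the sine and cosine
of `t + a`. Not being far means `|tan (t + a)| < κ`, which confines `t` to an interval of length
`2κ` inside an arc of length `2δ`. -/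
theorem uniformParams_real_notMem_farArms_le {l T : ℝ}
    (hα : α ∈ Set.Ioo (3 / 8 * Real.pi) (1 / 2 * Real.pi)) (hl : 0 < l) (hT : 0 < T)
    (x : Arms α) :
    (uniformParams α).real {θ | x ∉ farArms α l T θ} ≤
      1 / ((Real.pi / 2 - α) * (l + 1) * T) := by
  have hπ := Real.pi_pos
  obtain ⟨x, hx⟩ := x
  set δ := Real.pi / 2 - α with hδ
  have hδ0 : 0 < δ := by linarith [hα.2]
  have hδ1 : δ < Real.pi / 8 := by linarith [hα.1]
  set κ := 1 / ((l + 1) * T) with hκ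
  have hκ0 : 0 < κ := by positivity
  have hsq := sq_add_sq_of_norm_eq_one hx.1
  have hmeas : MeasurableSet {θ | (⟨x, hx⟩ : Arms α) ∉ farArms α l T θ} :=
    (measurableSet_mem_farArms l T _).compl
  set a := Real.arcsin (x 0) with ha
  have hx01 : -1 ≤ x 0 ∧ x 0 ≤ 1 := abs_le.1 (hx.2.2.trans (Real.cos_le_one α))
  have hsa : Real.sin a = x 0 := Real.sin_arcsin hx01.1 hx01.2
  have hca : Real.cos a = x 1 := by
    rw [ha, Real.cos_arcsin, show 1 - x 0 ^ 2 = x 1 ^ 2 by linarith, Real.sqrt_sq hx.2.1.le]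
  have haδ : |a| ≤ δ := by
    have h := abs_le.1 hx.2.2
    rw [← Real.sin_pi_div_two_sub, ← hδ] at h
    rw [abs_le]
    constructor
    · rw [ha, Real.le_arcsin_iff_sin_le' ⟨by linarith, by linarith⟩, Real.sin_neg]
      exact h.1
    · rw [ha, Real.arcsin_le_iff_le_sin' ⟨by linarith, by linarith⟩]
      exact h.2
  have hsub : Set.Icc (-δ) δ ∩ (fun t : ℝ => (!₂[Real.cos t, Real.sin t] :
      EuclideanSpace ℝ (Fin 2))) ⁻¹' {θ | (⟨x, hx⟩ : Arms α) ∉ farArms α l T θ} ⊆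
      Set.Icc (-a - κ) (-a + κ) := by
    rintro t ⟨ht, hfar⟩
    have h1 : along !₂[Real.cos t, Real.sin t] x = Real.sin (t + a) := by
      simp [along, Real.sin_add, hsa, hca]; ring
    have h2 : across !₂[Real.cos t, Real.sin t] x = Real.cos (t + a) := by
      simp [across, Real.cos_add, hsa, hca]
    simp only [farArms, Set.mem_preimage, Set.mem_ofPred_eq, h1, h2, not_le] at hfar
    have hta : |t + a| < Real.pi / 2 := by
      have := abs_add_le t a
      have := abs_le.2 ht
      linarith
    have hc : 0 < Real.cos (t + a) := Real.cos_pos_of_mem_Ioo (abs_lt.1 hta)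
    rw [abs_of_pos hc] at hfar
    have htan : |t + a| ≤ κ := by
      refine (abs_le_abs_tan hta).trans ?_
      rw [Real.tan_eq_sin_div_cos, abs_div, abs_of_pos hc, div_le_iff₀ hc, hκ, div_mul_eq_mul_div,
        le_div_iff₀ (by positivity)]
      linarith
    have := abs_le.1 htan
    constructor <;> linarith
  have hvol : volume.real (Set.Icc (-δ) δ) = 2 * δ := by
    rw [Real.volume_real_Icc_of_le (by linarith)]; ring
  rw [uniformParams, map_measureReal_apply measurable_circleParam hmeas, measureReal_def,
    cond_apply measurableSet_Icc, ENNReal.toReal_mul, ENNReal.toReal_inv, ← measureReal_def,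
    ← measureReal_def, ← hδ, hvol]
  have hle := measureReal_mono (μ := volume) hsub (by simp)
  rw [Real.volume_real_Icc_of_le (by linarith)] at hle
  calc _ ≤ (2 * δ)⁻¹ * (-a + κ - (-a - κ)) := by gcongr
    _ = _ := by rw [hκ]; field_simp; ring

end Uniform

/-! ### Choice of constants and assembly of the bound -/

section Final

theorem ofReal_integral_le_lintegral {X : Type*} [MeasurableSpace X] {μ : Measure X} {f : X → ℝ}
    (hf : Integrable f μ) :
    ENNReal.ofReal (∫ x, f x ∂μ) ≤ ∫⁻ x, ENNReal.ofReal (f x) ∂μ := by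
  rw [integral_eq_lintegral_pos_part_sub_lintegral_neg_part hf]
  exact (ENNReal.ofReal_le_ofReal (sub_le_self _ ENNReal.toReal_nonneg)).trans
    ENNReal.ofReal_toReal_le

/-- The upper bound keeps `N T²` below `1/16`; the lower bound yields the rate `l / √N`. -/
theorem tan_bounds {N : ℕ} (hN : 0 < N) :
    1 / (5 * √(N : ℝ)) ≤ Real.tan (1 / (5 * √(N : ℝ))) ∧
      Real.tan (1 / (5 * √(N : ℝ))) ≤ 1 / (4 * √(N : ℝ)) := by
  have hs : 1 ≤ √(N : ℝ) := Real.one_le_sqrt.2 (by exact_mod_cast hN)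
  set u := 1 / (5 * √(N : ℝ)) with hu
  have hu0 : 0 < u := by positivity
  have hu1 : u ≤ 1 / 5 := by
    rw [hu]; apply one_div_le_one_div_of_le <;> linarith
  have hπ := Real.pi_gt_three
  refine ⟨Real.le_tan hu0.le (by linarith), ?_⟩
  have hc : 4 / 5 ≤ Real.cos u := le_trans (by nlinarith) (Real.one_sub_sq_div_two_le_cos (x := u))
  rw [show 1 / (4 * √(N : ℝ)) = 5 / 4 * u by rw [hu]; field_simp, Real.tan_eq_sin_div_cos,
    div_le_iff₀ (by linarith)]
  nlinarith [Real.sin_le hu0.le]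

/-- The quadratic loss is negligible while `K` is at most about `m`, so `K = N` serves if `N + 1 ≤
m`, and otherwise `K = ⌈m - 1⌉`, or `0` if `m ≤ 1`. -/
theorem exists_le_sum_bound {m : ℝ} (hm : 0 < m) (N : ℕ) :
    ∃ K ≤ N, 1 / 2 * min (m - 1) (N : ℝ) ≤ 14 / 15 * (K : ℝ) - K * (K + 1) * (1 / (3 * m)) := by
  rcases le_total ((N : ℝ) + 1) m with h | h
  · refine ⟨N, le_rfl, ?_⟩
    rw [min_eq_right (by linarith)]
    have h1 : (N : ℝ) * (N + 1) * (1 / (3 * m)) ≤ N / 3 := by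
      rw [mul_one_div, div_le_div_iff₀ (by positivity) (by norm_num)]
      nlinarith [(Nat.cast_nonneg N : (0 : ℝ) ≤ N)]
    linarith [(Nat.cast_nonneg N : (0 : ℝ) ≤ N)]
  · rw [min_eq_left (by linarith)]
    rcases le_total m 1 with h1 | h1
    · exact ⟨0, Nat.zero_le _, by simp; linarith⟩
    refine ⟨⌈m - 1⌉₊, Nat.ceil_le.2 (by linarith), ?_⟩
    have hK1 := Nat.le_ceil (m - 1)
    have hK2 := Nat.ceil_lt_add_one (a := m - 1) (by linarith)
    set K : ℝ := (⌈m - 1⌉₊ : ℝ)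
    have hK0 : 0 ≤ K := Nat.cast_nonneg _
    rw [mul_one_div, le_sub_iff_add_le, ← le_sub_iff_add_le', div_le_iff₀ (by positivity)]
    nlinarith [mul_nonneg (by linarith : 0 ≤ m - K) (by linarith : 0 ≤ K + 1 - m),
      mul_nonneg hK0 (by linarith : 0 ≤ K + 1 - m), mul_nonneg hK0 hK0]

theorem sum_range_linear (ε : ℝ) (K : ℕ) :
    ∑ n ∈ Finset.range K, (2 * (1 - ((n + 1 : ℕ) : ℝ) * ε) - 16 / 15) =
      14 / 15 * (K : ℝ) - K * (K + 1) * ε := by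
  induction K with
  | zero => simp
  | succ K ih => rw [Finset.sum_range_succ, ih]; push_cast; ring

theorem cos_sub_cos_pos {α : ℝ} (hα : α ∈ Set.Ioo (3 / 8 * Real.pi) (1 / 2 * Real.pi)) :
    0 < Real.cos (3 / 8 * Real.pi) - Real.cos α :=
  sub_pos.2 (Real.cos_lt_cos_of_nonneg_of_le_pi (by positivity)
    (by linarith [hα.2, Real.pi_pos]) hα.1)

/-- Only the first `K` rounds are counted: the union bound weakens with `n` and may become negative
later, whereas the true probabilities dropped are nonnegative. -/
theorem ofReal_le_bayesRegret {α l T : ℝ}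
    (hα : α ∈ Set.Ioo (3 / 8 * Real.pi) (1 / 2 * Real.pi)) (hl : 0 < l) (hT : 0 < T)
    (φ : AgentPolicy (Arms α) Outcomes) {N K : ℕ} (hN : 0 < N) (hK : K ≤ N)
    (hTN : T ^ 2 ≤ 1 / (16 * N)) :
    ENNReal.ofReal ((Real.cos (3 / 8 * Real.pi) - Real.cos α) *
      (14 / 15 * (K : ℝ) - K * (K + 1) * (1 / ((Real.pi / 2 - α) * (l + 1) * T)))) ≤
        bayesRegret α l φ N := by
  have hN1 : (1 : ℝ) ≤ N := by exact_mod_cast hN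
  have hT1 : T ≤ 1 / 4 := by
    refine abs_le_of_sq_le_sq' (hTN.trans ?_) (by norm_num) |>.2
    rw [div_le_iff₀ (by positivity)]; linarith
  have hc := cos_sub_cos_pos hα
  set c := Real.cos (3 / 8 * Real.pi) - Real.cos α with hcdef
  have := isProbabilityMeasure_uniformParams hα.2
  have hmeas : ∀ x, MeasurableSet {θ | x ∈ farArms α l T θ} :=
    measurableSet_mem_farArms l T
  have hint : ∀ n, Integrable (fun θ => 2 * ∑ s, signWeight φ (signOutcome α)
      (halfWeight (farArms α l T θ)) n s - 16 / 15) (uniformParams α) := fun n =>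
    ((integrable_finsetSum _ fun s _ => integrable_signWeight_halfWeight φ _ _ hmeas n s).const_mul
      2).sub (integrable_const _)
  set g : EuclideanSpace ℝ (Fin 2) → ℝ := fun θ => c * ∑ n ∈ Finset.range K,
    (2 * ∑ s, signWeight φ (signOutcome α) (halfWeight (farArms α l T θ)) (n + 1) s - 16 / 15)
  have hg : Integrable g (uniformParams α) :=
    (integrable_finsetSum _ fun n _ => hint (n + 1)).const_mul c
  have hle : ∀ θ ∈ Params α, g θ ≤ regret α l θ φ N := fun θ hθ => by
    refine le_trans (mul_le_mul_of_nonneg_left ?_ hc.le) (sum_le_regret hα hl hT.le hT1 hθ φ N)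
    refine le_trans (Finset.sum_le_sum fun n hn => ?_) (Finset.sum_le_sum_of_subset_of_nonneg
      (Finset.range_subset_range.2 hK) fun n _ _ => measureReal_nonneg)
    refine le_trans ?_ (sum_likelihood_le_historyLaw hl hT.le hT1 θ φ n)
    refine le_trans (sub_le_sub_left ?_ _) (two_mul_sum_halfWeight_sub_le hl hT.le hT1 θ φ (n + 1))
    exact pow_inv_one_sub_sq_le hN (by have := Finset.mem_range.1 hn; omega) hTN
  refine le_trans ?_ ((ofReal_integral_le_lintegral hg).trans (lintegral_mono_ae
    ((ae_mem_params hα).mono fun θ hθ => ENNReal.ofReal_le_ofReal (hle θ hθ))))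
  refine ENNReal.ofReal_le_ofReal ?_
  rw [integral_const_mul, integral_finsetSum _ fun n _ => hint (n + 1), ← sum_range_linear]
  refine mul_le_mul_of_nonneg_left (Finset.sum_le_sum fun n _ => ?_) hc.le
  rw [integral_sub ((integrable_finsetSum _ fun s _ =>
    integrable_signWeight_halfWeight φ _ _ hmeas _ s).const_mul 2) (integrable_const _),
    integral_const_mul]
  have := one_sub_mul_le_integral_sum_signWeight φ (signOutcome α) (uniformParams α) hmeas
    (uniformParams_real_notMem_farArms_le hα hl hT) (n + 1)
  simp only [integral_const, probReal_univ, one_smul]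
  linarith

/-- The explicit lower bound for the Bayesian regret. -/
theorem ofReal_min_le_bayesRegret {α l : ℝ}
    (hα : α ∈ Set.Ioo (3 / 8 * Real.pi) (1 / 2 * Real.pi)) (hl : 0 < l)
    (φ : AgentPolicy (Arms α) Outcomes) {N : ℕ} (hN : 0 < N) :
    ENNReal.ofReal (1 / 2 * (Real.cos (3 / 8 * Real.pi) - Real.cos α) *
      min ((1 / 2 - α / Real.pi) * (l + 1) * Real.tan (1 / (5 * √(N : ℝ))) - 1) (N : ℝ)) ≤
        bayesRegret α l φ N := by
  have hπ := Real.pi_gt_three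
  have hπ0 := Real.pi_pos
  have hs : 0 < √(N : ℝ) := Real.sqrt_pos.2 (by exact_mod_cast hN)
  obtain ⟨hT1, hT2⟩ := tan_bounds hN
  set T := Real.tan (1 / (5 * √(N : ℝ)))
  have hT : 0 < T := lt_of_lt_of_le (by positivity) hT1
  have hTN : T ^ 2 ≤ 1 / (16 * N) := by
    refine (pow_le_pow_left₀ hT.le hT2 2).trans_eq ?_
    rw [div_pow, mul_pow, Real.sq_sqrt (Nat.cast_nonneg N)]; norm_num
  have hd : 0 < 1 / 2 - α / Real.pi := by
    rw [sub_pos, div_lt_iff₀ hπ0]; exact hα.2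
  set m := (1 / 2 - α / Real.pi) * (l + 1) * T with hm
  have hm0 : 0 < m := by positivity
  have hM : (Real.pi / 2 - α) * (l + 1) * T = Real.pi * m := by
    rw [hm]; field_simp
  obtain ⟨K, hK, hbound⟩ := exists_le_sum_bound hm0 N
  refine le_trans (ENNReal.ofReal_le_ofReal ?_) (ofReal_le_bayesRegret hα hl hT φ hN hK hTN)
  rw [hM, mul_comm (1 / 2 : ℝ), mul_assoc]
  -- The miss probability is `1 / (π m)`, at most `1 / (3 m)` since `π > 3`.
  refine mul_le_mul_of_nonneg_left (hbound.trans ?_) (cos_sub_cos_pos hα).le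
  gcongr

end Final

end ImpreciseBandit

end

theorem theorem6 (α : ℝ) (hα : α ∈ Set.Ioo (3 / 8 * Real.pi) (1 / 2 * Real.pi)) :
    (∀ l : ℝ, 0 < l → ∀ (φ : ImpreciseBandit.AgentPolicy (ImpreciseBandit.Arms α)
        ImpreciseBandit.Outcomes) (N : ℕ), 0 < N →
      (∀ θ ∈ ImpreciseBandit.Params α, 0 ≤ ImpreciseBandit.regret α l θ φ N) ∧
      ENNReal.ofReal (1 / 2 * (Real.cos (3 / 8 * Real.pi) - Real.cos α) *
          min ((1 / 2 - α / Real.pi) * (l + 1) * Real.tan (1 / (5 * √(N : ℝ))) - 1) (N : ℝ))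
        ≤ ImpreciseBandit.bayesRegret α l φ N) ∧
    (∃ c > (0 : ℝ), ∃ C > (0 : ℝ), ∀ (N : ℕ), 0 < N → ∀ l : ℝ, C * √(N : ℝ) ≤ l →
      ∀ φ : ImpreciseBandit.AgentPolicy (ImpreciseBandit.Arms α) ImpreciseBandit.Outcomes,
        ENNReal.ofReal (c * min (l / √(N : ℝ)) (N : ℝ)) ≤ ImpreciseBandit.bayesRegret α l φ N) := by
  have hc := ImpreciseBandit.cos_sub_cos_pos hα
  constructor
  · intro l hl φ N hN
    refine ⟨fun θ hθ => ?_, ImpreciseBandit.ofReal_min_le_bayesRegret hα hl φ hN⟩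
    -- Nonnegativity needs no tuning of nature: `T = 0` already gives a compatible policy that never
    -- beats the optimal value.
    refine le_trans (mul_nonneg hc.le (Finset.sum_nonneg fun n _ => measureReal_nonneg))
      (ImpreciseBandit.sum_le_regret (T := 0) hα hl le_rfl (by norm_num) hθ φ N)
  · have hd : 0 < 1 / 2 - α / Real.pi := by
      rw [sub_pos, div_lt_iff₀ Real.pi_pos]; exact hα.2
    set d := (1 / 2 - α / Real.pi) / 5 with hd5
    have hd0 : 0 < d := by positivity
    -- The main term is at least `d l / √N`, the `5` in `d` coming from `tan u ≥ u`. With `C = 2 /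
    -- d` it is at least `2`, so subtracting `1` costs at most half of it; hence `d / 2`.
    refine ⟨1 / 2 * (Real.cos (3 / 8 * Real.pi) - Real.cos α) * min (d / 2) 1, by positivity,
      2 / d, by positivity, fun N hN l hl φ => ?_⟩
    have hs : 0 < √(N : ℝ) := Real.sqrt_pos.2 (by exact_mod_cast hN)
    have hl0 : 0 < l := lt_of_lt_of_le (by positivity) hl
    refine le_trans (ENNReal.ofReal_le_ofReal ?_)
      (ImpreciseBandit.ofReal_min_le_bayesRegret hα hl0 φ hN)
    rw [mul_assoc]
    refine mul_le_mul_of_nonneg_left ?_ (by positivity)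
    have hz : 2 / d ≤ l / √(N : ℝ) := (le_div_iff₀ hs).2 hl
    have hz0 : 0 < l / √(N : ℝ) := by positivity
    have hN0 : (0 : ℝ) < N := by exact_mod_cast hN
    refine le_min ?_ ?_
    · have h1 : d * (l / √(N : ℝ)) ≤
          (1 / 2 - α / Real.pi) * (l + 1) * Real.tan (1 / (5 * √(N : ℝ))) := by
        calc d * (l / √(N : ℝ)) = (1 / 2 - α / Real.pi) * l * (1 / (5 * √(N : ℝ))) := by
              rw [hd5]; field_simp
          _ ≤ _ := by
            gcongr
            · linarith
            · exact (ImpreciseBandit.tan_bounds hN).1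
      have h2 : 2 ≤ d * (l / √(N : ℝ)) := by
        rw [div_le_iff₀ hd0] at hz; linarith
      have h3 : min (d / 2) 1 * min (l / √(N : ℝ)) (N : ℝ) ≤ d / 2 * (l / √(N : ℝ)) :=
        mul_le_mul (min_le_left _ _) (min_le_left _ _) (by positivity) (by positivity)
      linarith
    · calc _ ≤ 1 * (N : ℝ) :=
            mul_le_mul (min_le_right _ _) (min_le_right _ _) (by positivity) zero_le_one
        _ = N := one_mul _
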